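/- **Setting.** Let $d\in\{2,3\}$, $\Omega\subset\mathbb R^d$ a bounded domain, $I=(0,T)$ with $T>0$, $0<\varepsilon\le 1$, $\mathbf b\in L^\infty(\Omega)^d$ with $\nabla\cdot\mathbf b=0$ in the weak sense, $\alpha\in L^\infty(\Omega)$ with $\alpha\ge 0$, $f\in L^2(I;L^2(\Omega))$ and $u_0\in H^1_0(\Omega)$. Let $(\cdot,\cdot)$ and $(\cdot,\cdot)_K$ denote the inner products of $L^2(\Omega)$ and $L^2(K)$ (and, applied to elements of $H^{-1}(\Omega)$ and $H^1_0(\Omega)$, the duality pairing), and let $$V=\{v\in L^2(I;H^1_0(\Omega)) : \partial_t v\in L^2(I;H^{-1}(\Omega))\}\subset C([0,T];L^2(\Omega)).$$ Let $0=t_0<\dots<t_N=T$, $I_n=(t_{n-1},t_n]$, and for each $n$ let $\mathcal T_h^n$ be a decomposition of $\Omega$ into finitely many disjoint open elements (for example quadrilaterals or hexahedra). Let $V_h^{p,n}$ be the space of all $v\in H^1_0(\Omega)\cap C(\bar\Omega)$ whose restriction to each $K\in\mathcal T_h^n$ is a polynomial of degree at most $p$ in each variable, and let $V_{\tau h}=V_{\tau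 h}^{dG(r),p}$ be the space of functions whose restriction to each $I_n$ is a polynomial of degree at most $r$ in $t$ with values in $V_h^{p,n}$. Write $v_n^\pm=\lim_{t\to t_n\pm 0}v(t)$ and $[v]_n=v_n^+-v_n^-$; derivatives in time are taken slabwise. On $V+V_{\tau h}$ define $$A(u)(\varphi)=\sum_{n=1}^N\int_{I_n}\{(\partial_tu,\varphi)+(\varepsilon\nabla u,\nabla\varphi)+(\mathbf b\cdot\nabla u,\varphi)+(\alpha u,\varphi)\}\,dt+\sum_{n=2}^N([u]_{n-1},\varphi_{n-1}^+),\qquad F(\varphi)=\int_I(f,\varphi)\,dt,$$ $$A^*(z)(\psi)=\sum_{n=1}^N\int_{I_n}\{-(\partial_tz,\psi)-(\mathbf b\cdot\nabla z,\psi)+(\varepsilon\nabla z,\nabla\psi)+(\alpha z,\psi)\}\,dt-\sum_{n=2}^N([z]_{n-1},\psi_{n-1}^-).$$ Let $J:V+V_{\tau h}\to\mathbb R$ be three times Fréchet differentiable (with respect to the slabwise norm of $L^2(I_n;H^1_0(\Omega))\cap H^1(I_n;H^{-1}(\Omega))$), with $J'(v)(\psi)=\int_I(j(v),\psi)\,dt$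 for some $j(v)\in L^2(I;L^2(\Omega))$, for all $v,\psi\in V+V_{\tau h}$. For $v,w\in V_{\tau h}$ and real stabilization parameters $\delta_K,\delta_K^*$ (for $K\in\mathcal T_h^n$, $1\le n\le N$) let $$S(v)(w)=\sum_{n=1}^N\int_{I_n}\sum_{K\in\mathcal T_h^n}\delta_K(R(v),\mathbf b\cdot\nabla w)_K\,dt+\sum_{n=2}^N\sum_{K\in\mathcal T_h^n}\delta_K([v]_{n-1},\mathbf b\cdot\nabla w_{n-1}^+)_K+\sum_{K\in\mathcal T_h^1}\delta_K(v_0^+-u_0,\mathbf b\cdot\nabla w_0^+)_K,$$ with $R(v)=\partial_tv+\mathbf b\cdot\nabla v-\varepsilon\Delta v+\alpha v-f$ on each element. For a given $u_{\tau h}\in V_{\tau h}$ let, for $v,w\in V_{\tau h}$, $$S^*(v)(w)=\sum_{n=1}^N\int_{I_n}\sum_{K\in\mathcal T_h^n}\delta^*_K(R^*(v),-\mathbf b\cdot\nabla w)_K\,dt-\sum_{n=2}^N\sum_{K\in\mathcal T_h^{n-1}}\delta_K^*([v]_{n-1},-\mathbf b\cdot\nabla w_{n-1}^-)_K+\sum_{K\in\mathcal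 T_h^N}\delta_K^*(v_N^-,-\mathbf b\cdot\nabla w_N^-)_K,$$ with $R^*(v)=-\partial_tv-\mathbf b\cdot\nabla v-\varepsilon\Delta v+\alpha v-j(u_{\tau h})$ on each element. **Theorem.** Let $\{u,z\}\in V\times V$ be a stationary point, with respect to variations in $V\times V$, of the Lagrangian $$\mathcal L(u,z)=J(u)+F(z)-A(u)(z)-(u(0)-u_0,z(0)),\qquad (u,z)\in (V+V_{\tau h})\times V,$$ that is, $\mathcal L'(u,z)(\psi,\varphi)=0$ for all $\{\psi,\varphi\}\in V\times V$. Let $u_{\tau h},z_{\tau h}\in V_{\tau h}$ satisfy, for all $\varphi_{\tau h},\psi_{\tau h}\in V_{\tau h}$, $$A(u_{\tau h})(\varphi_{\tau h})+S(u_{\tau h})(\varphi_{\tau h})+(u_{\tau h,0}^+,\varphi_{\tau h,0}^+)=F(\varphi_{\tau h})+(u_0,\varphi_{\tau h,0}^+),$$ $$A^*(z_{\tau h})(\psi_{\tau h})+S^*(z_{\tau h})(\psi_{\tau h})+(z_{\tau h,N}^-,\psi_{\tau h,N}^-)=J'(u_{\tau h})(\psi_{\tau h}).$$ Define, for $\varphi,\psi\in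 V+V_{\tau h}$, $$\rho(u_{\tau h})(\varphi)=F(\varphi)-A(u_{\tau h})(\varphi)-(u_{\tau h,0}^+-u_0,\varphi_0^+),\qquad \rho^*(z_{\tau h})(\psi)=J'(u_{\tau h})(\psi)-A^*(z_{\tau h})(\psi)-(z_{\tau h,N}^-,\psi_N^-).$$ Then, with $e=u-u_{\tau h}$, for all $\varphi_{\tau h},\psi_{\tau h}\in V_{\tau h}$, $$\rho^*(z_{\tau h})(u-\psi_{\tau h})=\rho(u_{\tau h})(z-\varphi_{\tau h})+S(u_{\tau h})(\varphi_{\tau h}-z_{\tau h})+S^*(z_{\tau h})(u_{\tau h}-\psi_{\tau h})+\Delta\rho_J,$$ $$\Delta\rho_J=-\int_0^1J''(u_{\tau h}+s\,e)(e,e)\,ds.$$ -/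

import Mathlib

open MeasureTheory Set Filter
open scoped ENNReal ContDiff Topology

noncomputable section

namespace DWR

/-! ### Function spaces on a spatial domain -/

/-- The Euclidean space `ℝ^d`. -/
abbrev Pt (d : ℕ) := EuclideanSpace ℝ (Fin d)

/-- `L²(Ω)`. -/
abbrev L2 {d : ℕ} (Ω : Set (Pt d)) := Lp ℝ 2 (volume.restrict Ω)

/-- `L²(Ω)^d`. -/
abbrev L2Vec {d : ℕ} (Ω : Set (Pt d)) := Lp (Pt d) 2 (volume.restrict Ω)

/-- The pairs `(φ, ∇φ)` with `φ ∈ C_c^∞(Ω)`, as a subspace of `L²(Ω) × L²(Ω)^d` with its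
Hilbert norm `(‖v‖² + ‖w‖²)^{1/2}`, so that the norm of `(φ, ∇φ)` is the `H¹(Ω)` norm of `φ`. -/
def testGraph {d : ℕ} (Ω : Set (Pt d)) : Submodule ℝ (WithLp 2 (L2 Ω × L2Vec Ω)) where
  carrier := {y | ∃ φ : Pt d → ℝ, ContDiff ℝ ∞ φ ∧ HasCompactSupport φ ∧ tsupport φ ⊆ Ω ∧
    (y.fst =ᵐ[volume.restrict Ω] φ) ∧ (y.snd =ᵐ[volume.restrict Ω] gradient φ)}
  zero_mem' := by
    refine ⟨0, contDiff_const, HasCompactSupport.zero, by simp, ?_, ?_⟩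
    · exact Lp.coeFn_zero _ _ _
    · have h : gradient (0 : Pt d → ℝ) = 0 := by
        funext x
        simp [gradient]
      rw [h]
      exact Lp.coeFn_zero _ _ _
  add_mem' := by
    rintro y z ⟨φ, h1, h2, h3, h4, h5⟩ ⟨χ, k1, k2, k3, k4, k5⟩
    refine ⟨φ + χ, h1.add k1, h2.add k2, (tsupport_add φ χ).trans (union_subset h3 k3), ?_, ?_⟩
    · exact (Lp.coeFn_add _ _).trans (h4.add k4)
    · have h : gradient (φ + χ) = gradient φ + gradient χ := by
        funext x
        simp only [gradient, Pi.add_apply]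
        rw [fderiv_add (h1.differentiable (by simp) x) (k1.differentiable (by simp) x), map_add]
      rw [h]
      exact (Lp.coeFn_add _ _).trans (h5.add k5)
  smul_mem' := by
    rintro c y ⟨φ, h1, h2, h3, h4, h5⟩
    refine ⟨c • φ, h1.const_smul c, h2.smul_left (f := fun _ => c),
      (tsupport_smul_subset_right (fun _ => c) φ).trans h3, ?_, ?_⟩
    · exact (Lp.coeFn_smul _ _).trans (h4.const_smul c)
    · have h : gradient (c • φ) = c • gradient φ := by
        funext x
        simp only [gradient, Pi.smul_apply]
        rw [fderiv_const_smul (h1.differentiable (by simp) x)]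
        simp
      rw [h]
      exact (Lp.coeFn_smul _ _).trans (h5.const_smul c)

/-- `H^1_0(Ω)`, the closure of `C_c^∞(Ω)` in the `H¹(Ω)` norm; an element carries its function
and its weak gradient. -/
def H10 {d : ℕ} (Ω : Set (Pt d)) : Type := (testGraph Ω).topologicalClosure

instance {d : ℕ} (Ω : Set (Pt d)) : NormedAddCommGroup (H10 Ω) :=
  inferInstanceAs (NormedAddCommGroup (testGraph Ω).topologicalClosure)

instance {d : ℕ} (Ω : Set (Pt d)) : InnerProductSpace ℝ (H10 Ω) :=
  inferInstanceAs (InnerProductSpace ℝ (testGraph Ω).topologicalClosure)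

instance {d : ℕ} (Ω : Set (Pt d)) : CompleteSpace (H10 Ω) :=
  (testGraph Ω).isClosed_topologicalClosure.completeSpace_coe

variable {d : ℕ} {Ω : Set (Pt d)}

/-- The inclusion `H^1_0(Ω) → L²(Ω)`. -/
def incl (Ω : Set (Pt d)) : H10 Ω →L[ℝ] L2 Ω :=
  (WithLp.fstL 2 ℝ (L2 Ω) (L2Vec Ω)).comp (testGraph Ω).topologicalClosure.subtypeL

/-- The weak gradient `H^1_0(Ω) → L²(Ω)^d`. -/
def grad (Ω : Set (Pt d)) : H10 Ω →L[ℝ] L2Vec Ω :=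
  (WithLp.sndL 2 ℝ (L2 Ω) (L2Vec Ω)).comp (testGraph Ω).topologicalClosure.subtypeL

/-- `H^{-1}(Ω)`, the dual space of `H^1_0(Ω)`. -/
abbrev Hneg (Ω : Set (Pt d)) := H10 Ω →L[ℝ] ℝ

/-- For `i : X → H` into a real Hilbert space, the map `X → X'`, `v ↦ (i v, i ·)_H`. -/
def pivotEmb {X H : Type*} [NormedAddCommGroup X] [NormedSpace ℝ X] [NormedAddCommGroup H]
    [InnerProductSpace ℝ H] (i : X →L[ℝ] H) : X →L[ℝ] X →L[ℝ] ℝ :=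
  LinearMap.mkContinuous₂
    (LinearMap.mk₂ ℝ (fun v w : X => inner ℝ (i v) (i w))
      (fun v v' w => by rw [map_add, inner_add_left])
      (fun c v w => by rw [map_smul, real_inner_smul_left, smul_eq_mul])
      (fun v w w' => by rw [map_add, inner_add_right])
      (fun c v w => by rw [map_smul, real_inner_smul_right, smul_eq_mul]))
    (‖i‖ * ‖i‖) (fun v w => by
      calc ‖inner ℝ (i v) (i w)‖ ≤ ‖i v‖ * ‖i w‖ := norm_inner_le_norm _ _
        _ ≤ (‖i‖ * ‖v‖) * (‖i‖ * ‖w‖) := by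
          gcongr <;> exact ContinuousLinearMap.le_opNorm _ _
        _ = ‖i‖ * ‖i‖ * ‖v‖ * ‖w‖ := by ring)

/-- The embedding `H^1_0(Ω) → L²(Ω) → H^{-1}(Ω)`, `v ↦ (v, ·)`. -/
def dualEmb (Ω : Set (Pt d)) : H10 Ω →L[ℝ] Hneg Ω := pivotEmb (incl Ω)

/-! ### The convection-diffusion-reaction problem -/

/-- The data of `∂ₜu - ∇·(ε∇u) + b·∇u + αu = f` in `Ω × (0,T)`, `u = 0` on `∂Ω`, `u(0) = u₀`.
The time interval is written `(0,T]`, which differs from `(0,T)` by a null set. -/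
structure Problem (d : ℕ) where
  /-- the spatial domain -/
  Ω : Set (Pt d)
  isOpen_Ω : IsOpen Ω
  isConnected_Ω : IsConnected Ω
  isBounded_Ω : Bornology.IsBounded Ω
  /-- the final time -/
  T : ℝ
  T_pos : 0 < T
  /-- the diffusion coefficient -/
  ε : ℝ
  ε_pos : 0 < ε
  ε_le_one : ε ≤ 1
  /-- the flow field, essentially bounded and (weakly) divergence free -/
  b : Pt d → Pt d
  memLp_b : MemLp b ∞ (volume.restrict Ω)
  div_b : ∀ φ : Pt d → ℝ, ContDiff ℝ ∞ φ → HasCompactSupport φ → tsupport φ ⊆ Ω →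
    ∫ x in Ω, inner ℝ (b x) (gradient φ x) = 0
  /-- the reaction coefficient -/
  α : Pt d → ℝ
  memLp_α : MemLp α ∞ (volume.restrict Ω)
  α_nonneg : ∀ᵐ x ∂(volume.restrict Ω), 0 ≤ α x
  /-- the source term, `f ∈ L²(0,T;L²(Ω))` -/
  f : Lp (L2 Ω) 2 (volume.restrict (Ioc 0 T))
  /-- the initial value, `u₀ ∈ H^1_0(Ω)` -/
  u₀ : H10 Ω

/-- The time interval `I`. -/
abbrev Problem.I (P : Problem d) : Set ℝ := Ioc 0 P.T

/-- The spatial form `a(v)(w) = (ε∇v,∇w) + (b·∇v,w) + (αv,w)`. -/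
def Problem.a (P : Problem d) (v w : H10 P.Ω) : ℝ :=
  P.ε * inner ℝ (grad P.Ω v) (grad P.Ω w)
    + (∫ x in P.Ω, inner ℝ (P.b x) (grad P.Ω v x) * incl P.Ω w x)
    + ∫ x in P.Ω, P.α x * incl P.Ω v x * incl P.Ω w x

/-- The spatial form of the dual problem, `(ε∇v,∇w) - (b·∇v,w) + (αv,w)`. -/
def Problem.aDual (P : Problem d) (v w : H10 P.Ω) : ℝ :=
  P.ε * inner ℝ (grad P.Ω v) (grad P.Ω w)
    - (∫ x in P.Ω, inner ℝ (P.b x) (grad P.Ω v x) * incl P.Ω w x)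
    + ∫ x in P.Ω, P.α x * incl P.Ω v x * incl P.Ω w x

/-! ### The discretization in space and time -/

/-- A decomposition of `Ω` into finitely many disjoint open elements. Their shape
(quadrilaterals, hexahedra, ...) is left free, and hanging nodes are allowed. -/
structure Mesh (Ω : Set (Pt d)) where
  cells : Finset (Set (Pt d))
  isOpen_cell : ∀ K ∈ cells, IsOpen K
  nonempty_cell : ∀ K ∈ cells, K.Nonempty
  cell_subset : ∀ K ∈ cells, K ⊆ Ω
  disjoint_cells : ∀ K ∈ cells, ∀ K' ∈ cells, K ≠ K' → Disjoint K K'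
  closure_eq : closure Ω = ⋃ K ∈ cells, closure K

/-- `g` is on `K` a polynomial of degree at most `p` in each variable. -/
def IsCellPoly (p : ℕ) (K : Set (Pt d)) (g : Pt d → ℝ) (q : MvPolynomial (Fin d) ℝ) : Prop :=
  (∀ i, q.degreeOf i ≤ p) ∧ ∀ x ∈ K, g x = MvPolynomial.eval (fun i => x i) q

/-- The finite element space
`V_h^p = {v ∈ H^1_0(Ω) ∩ C(closure Ω) | v|_K ∈ Q^p(K) for all elements K}`. -/
def FESpace (𝒯 : Mesh Ω) (p : ℕ) : Submodule ℝ (H10 Ω) where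
  carrier := {v | ∃ g : Pt d → ℝ, ContinuousOn g (closure Ω) ∧
    (incl Ω v =ᵐ[volume.restrict Ω] g) ∧ ∀ K ∈ 𝒯.cells, ∃ q, IsCellPoly p K g q}
  zero_mem' := by
    refine ⟨0, continuousOn_const, ?_, fun K _ => ⟨0, by simp, by simp⟩⟩
    rw [map_zero]
    exact Lp.coeFn_zero _ _ _
  add_mem' := by
    rintro v w ⟨g, h1, h2, h3⟩ ⟨g', k1, k2, k3⟩
    refine ⟨g + g', h1.add k1, ?_, fun K hK => ?_⟩
    · rw [map_add]
      exact (Lp.coeFn_add _ _).trans (h2.add k2)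
    · obtain ⟨q, hq, hq'⟩ := h3 K hK
      obtain ⟨s, hs, hs'⟩ := k3 K hK
      exact ⟨q + s, fun i => (MvPolynomial.degreeOf_add_le i q s).trans (max_le (hq i) (hs i)),
        fun x hx => by simp [hq' x hx, hs' x hx]⟩
  smul_mem' := by
    rintro c v ⟨g, h1, h2, h3⟩
    refine ⟨c • g, h1.const_smul c, ?_, fun K hK => ?_⟩
    · rw [map_smul]
      exact (Lp.coeFn_smul _ _).trans (h2.const_smul c)
    · obtain ⟨q, hq, hq'⟩ := h3 K hK
      refine ⟨MvPolynomial.C c * q, fun i => (MvPolynomial.degreeOf_C_mul_le q i c).trans (hq i),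
        fun x hx => by simp [hq' x hx]⟩

theorem FESpace.exists_cellPoly {𝒯 : Mesh Ω} {p : ℕ} (v : FESpace 𝒯 p) (K : 𝒯.cells) :
    ∃ q : MvPolynomial (Fin d) ℝ, (∀ i, q.degreeOf i ≤ p) ∧
      ∀ᵐ x ∂(volume.restrict (K : Set (Pt d))),
        incl Ω v x = MvPolynomial.eval (fun i => x i) q := by
  obtain ⟨g, -, h2, h3⟩ := v.2
  obtain ⟨q, hq, hq'⟩ := h3 K K.2
  refine ⟨q, hq, ?_⟩
  filter_upwards [ae_restrict_of_ae_restrict_of_subset (𝒯.cell_subset K K.2) h2,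
    ae_restrict_mem (𝒯.isOpen_cell K K.2).measurableSet] with x hx hxK
  rw [hx, hq' x hxK]

/-- Two polynomials that agree almost everywhere on a nonempty open set are equal. -/
theorem cellPoly_unique {K : Set (Pt d)} (hK : IsOpen K) (hne : K.Nonempty)
    {q s : MvPolynomial (Fin d) ℝ}
    (h : ∀ᵐ x ∂(volume.restrict K), MvPolynomial.eval (fun i => x i) q
      = MvPolynomial.eval (fun i => x i) s) : q = s := by
  have hc : ∀ q : MvPolynomial (Fin d) ℝ,
      Continuous fun x : Pt d => MvPolynomial.eval (fun i => x i) q := fun q =>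
    (MvPolynomial.continuous_eval q).comp (PiLp.continuous_ofLp 2 _)
  have hEq : EqOn (fun x : Pt d => MvPolynomial.eval (fun i => x i) q)
      (fun x => MvPolynomial.eval (fun i => x i) s) K :=
    Measure.eqOn_open_of_ae_eq h hK (hc q).continuousOn (hc s).continuousOn
  obtain ⟨y, hy⟩ := hne
  have hK' : IsOpen ((WithLp.toLp 2 : (Fin d → ℝ) → Pt d) ⁻¹' K) :=
    hK.preimage (PiLp.continuous_toLp 2 _)
  obtain ⟨U, hU, hUK⟩ := isOpen_pi_iff'.1 hK' (WithLp.ofLp y) hy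
  refine MvPolynomial.funext_set U (fun i => ?_) fun x hx => ?_
  · exact infinite_of_mem_nhds _ ((hU i).1.mem_nhds (hU i).2)
  · exact hEq (hUK hx)

/-- The polynomial which the finite element function `v` is on the element `K`. -/
def FESpace.cellPoly {𝒯 : Mesh Ω} {p : ℕ} (K : 𝒯.cells) :
    FESpace 𝒯 p →ₗ[ℝ] MvPolynomial (Fin d) ℝ where
  toFun v := Classical.choose (FESpace.exists_cellPoly v K)
  map_add' v w := by
    have hv := (Classical.choose_spec (FESpace.exists_cellPoly v K)).2
    have hw := (Classical.choose_spec (FESpace.exists_cellPoly w K)).2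
    have hvw := (Classical.choose_spec (FESpace.exists_cellPoly (v + w) K)).2
    refine cellPoly_unique (𝒯.isOpen_cell K K.2) (𝒯.nonempty_cell K K.2) ?_
    have hadd : ∀ᵐ x ∂(volume.restrict (K : Set (Pt d))),
        incl Ω (v + w : FESpace 𝒯 p) x = incl Ω v x + incl Ω w x := by
      refine ae_restrict_of_ae_restrict_of_subset (𝒯.cell_subset K K.2) ?_
      have e : incl Ω ((v + w : FESpace 𝒯 p) : H10 Ω) = incl Ω v + incl Ω w :=
        map_add (incl Ω) (v : H10 Ω) (w : H10 Ω)
      rw [e]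
      exact Lp.coeFn_add _ _
    filter_upwards [hv, hw, hvw, hadd] with x h1 h2 h3 h4
    rw [(MvPolynomial.eval _).map_add, ← h3, ← h1, ← h2, h4]
  map_smul' c v := by
    have hv := (Classical.choose_spec (FESpace.exists_cellPoly v K)).2
    have hcv := (Classical.choose_spec (FESpace.exists_cellPoly (c • v) K)).2
    refine cellPoly_unique (𝒯.isOpen_cell K K.2) (𝒯.nonempty_cell K K.2) ?_
    have hsmul : ∀ᵐ x ∂(volume.restrict (K : Set (Pt d))),
        incl Ω (c • v : FESpace 𝒯 p) x = c * incl Ω v x := by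
      refine ae_restrict_of_ae_restrict_of_subset (𝒯.cell_subset K K.2) ?_
      have e : incl Ω ((c • v : FESpace 𝒯 p) : H10 Ω) = c • incl Ω v :=
        map_smul (incl Ω) c (v : H10 Ω)
      rw [e]
      exact Lp.coeFn_smul _ _
    filter_upwards [hv, hcv, hsmul] with x h1 h2 h3
    rw [RingHom.id_apply, MvPolynomial.smul_eval, ← h2, ← h1, h3]

/-- The elementwise Laplacian `Δ(v|_K)(x)`. -/
def FESpace.cellLaplacian {𝒯 : Mesh Ω} {p : ℕ} (K : 𝒯.cells) (v : FESpace 𝒯 p) (x : Pt d) : ℝ :=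
  MvPolynomial.eval (fun i => x i)
    (∑ i, MvPolynomial.pderiv i (MvPolynomial.pderiv i (FESpace.cellPoly K v)))

/-- The discretization parameters. There are `N = M + 1` time slabs; slab `n : Fin (M + 1)` is
`(node n.castSucc, node n.succ]` and has its own spatial mesh. -/
structure Discretization (P : Problem d) where
  /-- the number of interior time nodes -/
  M : ℕ
  /-- the time nodes -/
  node : Fin (M + 2) → ℝ
  node_strictMono : StrictMono node
  node_zero : node 0 = 0
  node_last : node (Fin.last (M + 1)) = P.T
  /-- the spatial mesh on each slab -/
  mesh : Fin (M + 1) → Mesh P.Ω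
  /-- the polynomial degree in time -/
  r : ℕ
  /-- the polynomial degree in space -/
  p : ℕ
  /-- the stabilization parameters `δ_K` of the primal problem -/
  δ : ∀ n : Fin (M + 1), (mesh n).cells → ℝ
  /-- the stabilization parameters `δ*_K` of the dual problem -/
  δDual : ∀ n : Fin (M + 1), (mesh n).cells → ℝ

variable {P : Problem d}

/-- The time slab `I_n`. -/
def Discretization.slab (D : Discretization P) (n : Fin (D.M + 1)) : Set ℝ :=
  Ioc (D.node n.castSucc) (D.node n.succ)

/-! ### The space containing the exact and the discrete functions -/

/-- Ambient space for functions of time: the function `v ∈ L²(I;H^1_0(Ω))`, its (slabwise) time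
derivative in `L²(I;H^{-1}(Ω))`, and on each slab `(t_{n-1},t_n]` the one-sided limits in `L²(Ω)`
at the left end, `v_{n-1}^+`, and at the right end, `v_n^-`. -/
abbrev Broken (D : Discretization P) :=
  Lp (H10 P.Ω) 2 (volume.restrict P.I) × Lp (Hneg P.Ω) 2 (volume.restrict P.I) ×
    (Fin (D.M + 1) → L2 P.Ω) × (Fin (D.M + 1) → L2 P.Ω)

namespace Broken

variable {D : Discretization P}

/-- the value at time `t` -/
def val (v : Broken D) (t : ℝ) : H10 P.Ω := v.1 t

/-- the time derivative at time `t` -/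
def dt (v : Broken D) (t : ℝ) : Hneg P.Ω := v.2.1 t

/-- the limit from above at the left end of slab `n` -/
def leftVal (v : Broken D) (n : Fin (D.M + 1)) : L2 P.Ω := v.2.2.1 n

/-- the limit from below at the right end of slab `n` -/
def rightVal (v : Broken D) (n : Fin (D.M + 1)) : L2 P.Ω := v.2.2.2 n

/-- the jump `[v] = v⁺ - v⁻` at the interior node between the slabs `m` and `m + 1` -/
def jump (v : Broken D) (m : Fin D.M) : L2 P.Ω := v.leftVal m.succ - v.rightVal m.castSucc

/-- `v(0)`, respectively `v_0^+` -/
def initial (v : Broken D) : L2 P.Ω := v.leftVal 0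

/-- `v(T)`, respectively `v_N^-` -/
def final (v : Broken D) : L2 P.Ω := v.rightVal (Fin.last D.M)

end Broken

/-- `w` is the weak time derivative of `v` on `(0,T)`: `∫ η' v dt = - ∫ η w dt` in `H^{-1}(Ω)` for
all `η ∈ C_c^∞(0,T)`. -/
def IsWeakTimeDeriv (P : Problem d) (v : Lp (H10 P.Ω) 2 (volume.restrict P.I))
    (w : Lp (Hneg P.Ω) 2 (volume.restrict P.I)) : Prop :=
  ∀ η : ℝ → ℝ, ContDiff ℝ ∞ η → HasCompactSupport η → tsupport η ⊆ Ioo 0 P.T →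
    ∫ t in P.I, deriv η t • dualEmb P.Ω (v t) = - ∫ t in P.I, η t • w t

theorem integrable_testFun_smul {Y : Type*} [NormedAddCommGroup Y] [NormedSpace ℝ Y]
    {T : ℝ} (g : ℝ → Y) (hg : MemLp g 2 (volume.restrict (Ioc 0 T))) {η : ℝ → ℝ}
    (h1 : Continuous η) (h2 : HasCompactSupport η) :
    Integrable (fun t => η t • g t) (volume.restrict (Ioc 0 T)) := by
  obtain ⟨C, hC⟩ := h2.exists_bound_of_continuous h1
  exact (hg.integrable (by norm_num)).bdd_smul C h1.aestronglyMeasurable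
    (Eventually.of_forall hC)

/-- The space `V = {v ∈ L²(I;H^1_0(Ω)) | ∂ₜv ∈ L²(I;H^{-1}(Ω))}`. As usual its elements are
identified with their representatives in `C([0,T];L²(Ω))`, which give the values at the nodes. -/
def V (D : Discretization P) : Submodule ℝ (Broken D) where
  carrier := {v | IsWeakTimeDeriv P v.1 v.2.1 ∧ ∃ g : ℝ → L2 P.Ω, ContinuousOn g (Icc 0 P.T) ∧
    (∀ᵐ t ∂(volume.restrict P.I), incl P.Ω (v.val t) = g t) ∧
    ∀ n, v.leftVal n = g (D.node n.castSucc) ∧ v.rightVal n = g (D.node n.succ)}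
  zero_mem' := by
    refine ⟨?_, 0, continuousOn_const, ?_, fun n => ⟨rfl, rfl⟩⟩
    · intro η h1 h2 _
      have e1 : ∀ᵐ t ∂(volume.restrict P.I),
          deriv η t • dualEmb P.Ω ((0 : Broken D).1 t) = 0 := by
        filter_upwards [Lp.coeFn_zero (H10 P.Ω) 2 (volume.restrict P.I)] with t ht
        rw [Prod.fst_zero, ht, Pi.zero_apply, map_zero, smul_zero]
      have e2 : ∀ᵐ t ∂(volume.restrict P.I), η t • (0 : Broken D).2.1 t = 0 := by
        filter_upwards [Lp.coeFn_zero (Hneg P.Ω) 2 (volume.restrict P.I)] with t ht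
        rw [Prod.snd_zero, Prod.fst_zero, ht, Pi.zero_apply, smul_zero]
      rw [integral_eq_zero_of_ae e1, integral_eq_zero_of_ae e2, neg_zero]
    · filter_upwards [Lp.coeFn_zero (H10 P.Ω) 2 (volume.restrict P.I)] with t ht
      rw [Broken.val, Prod.fst_zero, ht, Pi.zero_apply, map_zero, Pi.zero_apply]
  add_mem' := by
    rintro v w ⟨hv, g, hg, hvg, hgn⟩ ⟨hw, k, hk, hwk, hkn⟩
    refine ⟨?_, g + k, hg.add hk, ?_, fun n => ⟨?_, ?_⟩⟩
    · intro η h1 h2 h3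
      have e1 : ∀ᵐ t ∂(volume.restrict P.I), deriv η t • dualEmb P.Ω ((v + w).1 t)
          = deriv η t • dualEmb P.Ω (v.1 t) + deriv η t • dualEmb P.Ω (w.1 t) := by
        filter_upwards [Lp.coeFn_add v.1 w.1] with t ht
        rw [Prod.fst_add, ht, Pi.add_apply, map_add, smul_add]
      have e2 : ∀ᵐ t ∂(volume.restrict P.I), η t • (v + w).2.1 t
          = η t • v.2.1 t + η t • w.2.1 t := by
        filter_upwards [Lp.coeFn_add v.2.1 w.2.1] with t ht
        rw [Prod.snd_add, Prod.fst_add, ht, Pi.add_apply, smul_add]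
      have hd := h1.continuous_deriv (by simp)
      rw [integral_congr_ae e1, integral_congr_ae e2, integral_add, integral_add, hv η h1 h2 h3,
        hw η h1 h2 h3, neg_add]
      · exact integrable_testFun_smul _ (Lp.memLp v.2.1) h1.continuous h2
      · exact integrable_testFun_smul _ (Lp.memLp w.2.1) h1.continuous h2
      · exact integrable_testFun_smul _ ((dualEmb P.Ω).comp_memLp v.1) hd h2.deriv
      · exact integrable_testFun_smul _ ((dualEmb P.Ω).comp_memLp w.1) hd h2.deriv
    · filter_upwards [Lp.coeFn_add v.1 w.1, hvg, hwk] with t ht h1 h2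
      rw [Broken.val, Prod.fst_add, ht, Pi.add_apply, map_add, Pi.add_apply, ← h1, ← h2]
      rfl
    · rw [Pi.add_apply, ← (hgn n).1, ← (hkn n).1]
      rfl
    · rw [Pi.add_apply, ← (hgn n).2, ← (hkn n).2]
      rfl
  smul_mem' := by
    rintro c v ⟨hv, g, hg, hvg, hgn⟩
    refine ⟨?_, c • g, hg.const_smul c, ?_, fun n => ⟨?_, ?_⟩⟩
    · intro η h1 h2 h3
      have e1 : ∀ᵐ t ∂(volume.restrict P.I), deriv η t • dualEmb P.Ω ((c • v).1 t)
          = c • (deriv η t • dualEmb P.Ω (v.1 t)) := by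
        filter_upwards [Lp.coeFn_smul c v.1] with t ht
        rw [Prod.smul_fst, ht, Pi.smul_apply, map_smul, smul_comm]
      have e2 : ∀ᵐ t ∂(volume.restrict P.I), η t • (c • v).2.1 t = c • (η t • v.2.1 t) := by
        filter_upwards [Lp.coeFn_smul c v.2.1] with t ht
        rw [Prod.smul_snd, Prod.smul_fst, ht, Pi.smul_apply, smul_comm]
      rw [integral_congr_ae e1, integral_congr_ae e2, integral_smul, integral_smul,
        hv η h1 h2 h3, smul_neg]
    · filter_upwards [Lp.coeFn_smul c v.1, hvg] with t ht h1
      rw [Broken.val, Prod.smul_fst, ht, Pi.smul_apply, map_smul, Pi.smul_apply, ← h1]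
      rfl
    · rw [Pi.smul_apply, ← (hgn n).1]
      rfl
    · rw [Pi.smul_apply, ← (hgn n).2]
      rfl

/-! ### Discrete functions -/

/-- `V_{τh}^{dG(r),p}`: on each slab a polynomial `∑ k, t^k c_k` in time of degree at most `r` with
coefficients in the finite element space of that slab. -/
abbrev DG (D : Discretization P) :=
  (n : Fin (D.M + 1)) → Fin (D.r + 1) → FESpace (D.mesh n) D.p

namespace DG

variable {D : Discretization P}

/-- the polynomial of slab `n` at time `t` -/
def slabVal (v : DG D) (n : Fin (D.M + 1)) (t : ℝ) : FESpace (D.mesh n) D.p :=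
  ∑ k : Fin (D.r + 1), t ^ (k : ℕ) • v n k

/-- the time derivative of the polynomial of slab `n` at time `t` -/
def slabDt (v : DG D) (n : Fin (D.M + 1)) (t : ℝ) : FESpace (D.mesh n) D.p :=
  ∑ k : Fin (D.r + 1), ((k : ℝ) * t ^ ((k : ℕ) - 1)) • v n k

theorem slabVal_add (v w : DG D) (n : Fin (D.M + 1)) (t : ℝ) :
    (v + w).slabVal n t = v.slabVal n t + w.slabVal n t := by
  simp [slabVal, Finset.sum_add_distrib]

theorem slabVal_smul (c : ℝ) (v : DG D) (n : Fin (D.M + 1)) (t : ℝ) :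
    (c • v).slabVal n t = c • v.slabVal n t := by
  simp only [slabVal, Pi.smul_apply, Finset.smul_sum]
  exact Finset.sum_congr rfl fun k _ => smul_comm _ _ _

theorem slabDt_add (v w : DG D) (n : Fin (D.M + 1)) (t : ℝ) :
    (v + w).slabDt n t = v.slabDt n t + w.slabDt n t := by
  simp [slabDt, Finset.sum_add_distrib]

theorem slabDt_smul (c : ℝ) (v : DG D) (n : Fin (D.M + 1)) (t : ℝ) :
    (c • v).slabDt n t = c • v.slabDt n t := by
  simp only [slabDt, Pi.smul_apply, Finset.smul_sum]
  exact Finset.sum_congr rfl fun k _ => smul_comm _ _ _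

theorem continuous_slabVal (v : DG D) (n : Fin (D.M + 1)) : Continuous (v.slabVal n) := by
  unfold slabVal
  fun_prop

theorem continuous_slabDt (v : DG D) (n : Fin (D.M + 1)) : Continuous (v.slabDt n) := by
  unfold slabDt
  fun_prop

/-- the function of time which is `g n` on slab `n` -/
def glue {Y : Type*} [AddCommMonoid Y] (D : Discretization P) (g : Fin (D.M + 1) → ℝ → Y)
    (t : ℝ) : Y :=
  ∑ n, (D.slab n).indicator (g n) t

theorem memLp_glue {Y : Type*} [NormedAddCommGroup Y] (D : Discretization P)
    {g : Fin (D.M + 1) → ℝ → Y} (hg : ∀ n, Continuous (g n)) :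
    MemLp (glue D g) 2 (volume.restrict P.I) := by
  unfold glue
  refine memLp_finsetSum _ fun n _ => MemLp.indicator measurableSet_Ioc ?_
  obtain ⟨C, hC⟩ := (isCompact_Icc (a := 0) (b := P.T)).exists_bound_of_continuousOn
    (hg n).continuousOn
  refine MemLp.of_bound (hg n).aestronglyMeasurable C ?_
  filter_upwards [ae_restrict_mem measurableSet_Ioc] with t ht
  exact hC t (Ioc_subset_Icc_self ht)

/-- the value in `H^1_0(Ω)` at time `t` -/
def val (v : DG D) : ℝ → H10 P.Ω := glue D fun n t => (v.slabVal n t : H10 P.Ω)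

/-- the slabwise time derivative at time `t`, as an element of `H^{-1}(Ω)` -/
def dt (v : DG D) : ℝ → Hneg P.Ω := glue D fun n t => dualEmb P.Ω (v.slabDt n t)

theorem memLp_val (v : DG D) : MemLp v.val 2 (volume.restrict P.I) :=
  memLp_glue D fun n => continuous_subtype_val.comp (v.continuous_slabVal n)

theorem memLp_dt (v : DG D) : MemLp v.dt 2 (volume.restrict P.I) :=
  memLp_glue D fun n =>
    (dualEmb P.Ω).continuous.comp (continuous_subtype_val.comp (v.continuous_slabDt n))

/-- A discrete function as an element of the ambient space. -/
def toBroken : DG D →ₗ[ℝ] Broken D where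
  toFun v := (v.memLp_val.toLp, v.memLp_dt.toLp,
    fun n => incl P.Ω (v.slabVal n (D.node n.castSucc)),
    fun n => incl P.Ω (v.slabVal n (D.node n.succ)))
  map_add' v w := by
    have h1 : (v + w).val = v.val + w.val := by
      funext t
      simp only [val, glue, slabVal_add, Pi.add_apply, ← Finset.sum_add_distrib]
      exact Finset.sum_congr rfl fun n _ => congrFun (indicator_add _ _ _) t
    have h2 : (v + w).dt = v.dt + w.dt := by
      funext t
      simp only [dt, glue, slabDt_add, Submodule.coe_add, map_add, Pi.add_apply,
        ← Finset.sum_add_distrib]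
      exact Finset.sum_congr rfl fun n _ => congrFun (indicator_add _ _ _) t
    refine Prod.ext ?_ (Prod.ext ?_ (Prod.ext ?_ ?_))
    · simp only [h1, Prod.fst_add]
      exact MemLp.toLp_add _ _
    · simp only [h2, Prod.fst_add, Prod.snd_add]
      exact MemLp.toLp_add _ _
    · funext n
      simp [slabVal_add]
    · funext n
      simp [slabVal_add]
  map_smul' c v := by
    have h1 : (c • v).val = c • v.val := by
      funext t
      simp only [val, glue, slabVal_smul, Pi.smul_apply, Finset.smul_sum]
      exact Finset.sum_congr rfl fun n _ => congrFun (indicator_const_smul _ _ _) t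
    have h2 : (c • v).dt = c • v.dt := by
      funext t
      simp only [dt, glue, slabDt_smul, Submodule.coe_smul, map_smul, Pi.smul_apply,
        Finset.smul_sum]
      exact Finset.sum_congr rfl fun n _ => congrFun (indicator_const_smul _ _ _) t
    refine Prod.ext ?_ (Prod.ext ?_ (Prod.ext ?_ ?_))
    · simp only [h1, Prod.smul_fst, RingHom.id_apply]
      exact MemLp.toLp_const_smul _ _
    · simp only [h2, Prod.smul_fst, Prod.smul_snd, RingHom.id_apply]
      exact MemLp.toLp_const_smul _ _
    · funext n
      simp [slabVal_smul]
    · funext n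
      simp [slabVal_smul]

end DG

/-- `V + V_{τh}^{dG(r),p}` as a subspace of the ambient space. -/
def sumSpace (D : Discretization P) : Submodule ℝ (Broken D) :=
  V D ⊔ LinearMap.range DG.toBroken

/-- The normed space `V + V_{τh}^{dG(r),p}`, with the norm of the ambient space. -/
def W (D : Discretization P) : Type := sumSpace D

instance (D : Discretization P) : NormedAddCommGroup (W D) :=
  inferInstanceAs (NormedAddCommGroup (sumSpace D))

instance (D : Discretization P) : NormedSpace ℝ (W D) :=
  inferInstanceAs (NormedSpace ℝ (sumSpace D))

/-- the inclusion of `V + V_{τh}^{dG(r),p}` in the ambient space -/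
def W.toBroken {D : Discretization P} : W D →L[ℝ] Broken D := (sumSpace D).subtypeL

/-- the inclusion of `V` in `V + V_{τh}^{dG(r),p}` -/
def V.toW {D : Discretization P} : V D →ₗ[ℝ] W D :=
  Submodule.inclusion (le_sup_left : V D ≤ sumSpace D)

/-- the inclusion of `V_{τh}^{dG(r),p}` in `V + V_{τh}^{dG(r),p}` -/
def DG.toW {D : Discretization P} : DG D →ₗ[ℝ] W D :=
  (Submodule.inclusion (le_sup_right : LinearMap.range DG.toBroken ≤ sumSpace D)).comp
    DG.toBroken.rangeRestrict

/-! ### Forms, residuals and stabilization -/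

section Forms

variable {D : Discretization P}

/-- `A(u)(φ) = ∑_{n=1}^N ∫_{I_n} {(∂ₜu,φ) + a(u)(φ)} dt + ∑_{n=2}^N ([u]_{n-1}, φ_{n-1}^+)`. -/
def A (u φ : Broken D) : ℝ :=
  (∑ n, ∫ t in D.slab n, (u.dt t (φ.val t) + P.a (u.val t) (φ.val t)))
    + ∑ m, inner ℝ (u.jump m) (φ.leftVal m.succ)

/-- `F(φ) = ∫_I (f,φ) dt`. -/
def F (φ : Broken D) : ℝ := ∫ t in P.I, inner ℝ (P.f t) (incl P.Ω (φ.val t))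

/-- `A*(z)(ψ) = ∑_{n=1}^N ∫_{I_n} {-(∂ₜz,ψ) - (b·∇z,ψ) + (ε∇z,∇ψ) + (αz,ψ)} dt
- ∑_{n=2}^N ([z]_{n-1}, ψ_{n-1}^-)`. -/
def ADual (z ψ : Broken D) : ℝ :=
  (∑ n, ∫ t in D.slab n, (-(z.dt t (ψ.val t)) + P.aDual (z.val t) (ψ.val t)))
    - ∑ m, inner ℝ (z.jump m) (ψ.rightVal m.castSucc)

/-- The streamline derivative `b·∇v` at the point `x`. -/
def streamDeriv (v : H10 P.Ω) (x : Pt d) : ℝ := inner ℝ (P.b x) (grad P.Ω v x)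

/-- The elementwise residual `R(u) = ∂ₜu + b·∇u - ∇·(ε∇u) + αu - f` on `K` at time `t` of slab
`n`. -/
def residual (u : DG D) (n : Fin (D.M + 1)) (K : (D.mesh n).cells) (t : ℝ) (x : Pt d) : ℝ :=
  incl P.Ω (u.slabDt n t) x + streamDeriv (u.slabVal n t : H10 P.Ω) x
    - P.ε * FESpace.cellLaplacian K (u.slabVal n t) x + P.α x * incl P.Ω (u.slabVal n t) x - P.f t x

/-- The elementwise residual `R*(z) = -∂ₜz - b·∇z - ∇·(ε∇z) + αz - j` on `K` at time `t` of slab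
`n`. -/
def residualDual (j : Lp (L2 P.Ω) 2 (volume.restrict P.I)) (z : DG D) (n : Fin (D.M + 1))
    (K : (D.mesh n).cells) (t : ℝ) (x : Pt d) : ℝ :=
  -(incl P.Ω (z.slabDt n t) x) - streamDeriv (z.slabVal n t : H10 P.Ω) x
    - P.ε * FESpace.cellLaplacian K (z.slabVal n t) x + P.α x * incl P.Ω (z.slabVal n t) x - j t x

/-- The primal SUPG stabilization `S(u)(φ)`. A jump at the left end of a slab is tested on the mesh
of this slab, the one on which `φ^+` is defined. -/
def S (u φ : DG D) : ℝ :=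
  (∑ n, ∫ t in D.slab n, ∑ K, D.δ n K *
      ∫ x in (K : Set (Pt d)), residual u n K t x * streamDeriv (φ.slabVal n t : H10 P.Ω) x)
    + (∑ m : Fin D.M, ∑ K, D.δ m.succ K * ∫ x in (K : Set (Pt d)), (DG.toBroken u).jump m x
        * streamDeriv (φ.slabVal m.succ (D.node m.succ.castSucc) : H10 P.Ω) x)
    + ∑ K, D.δ 0 K * ∫ x in (K : Set (Pt d)),
        ((DG.toBroken u).initial - incl P.Ω P.u₀ : L2 P.Ω) x
          * streamDeriv (φ.slabVal 0 (D.node 0) : H10 P.Ω) x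

/-- The dual SUPG stabilization `S*(z)(ψ)`. A jump at the right end of a slab is tested on the mesh
of this slab, the one on which `ψ^-` is defined. -/
def SDual (j : Lp (L2 P.Ω) 2 (volume.restrict P.I)) (z ψ : DG D) : ℝ :=
  (∑ n, ∫ t in D.slab n, ∑ K, D.δDual n K *
      ∫ x in (K : Set (Pt d)), residualDual j z n K t x
        * -streamDeriv (ψ.slabVal n t : H10 P.Ω) x)
    - (∑ m : Fin D.M, ∑ K, D.δDual m.castSucc K * ∫ x in (K : Set (Pt d)),
        (DG.toBroken z).jump m x
          * -streamDeriv (ψ.slabVal m.castSucc (D.node m.castSucc.succ) : H10 P.Ω) x)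
    + ∑ K, D.δDual (Fin.last D.M) K * ∫ x in (K : Set (Pt d)), (DG.toBroken z).final x
        * -streamDeriv (ψ.slabVal (Fin.last D.M) P.T : H10 P.Ω) x

/-- The Lagrangian `L(u,z) = J(u) + F(z) - A(u)(z) - (u(0) - u₀, z(0))` on `(V + V_{τh}) × V`; the
jumps of `u` are part of `A`. -/
def lagrangian (J : W D → ℝ) (u : W D) (z : V D) : ℝ :=
  J u + F (z : Broken D) - A u.toBroken z
    - inner ℝ (u.toBroken.initial - incl P.Ω P.u₀) (z : Broken D).initial

/-- `{u,z} ∈ V × V` is a stationary point of the Lagrangian: `L'(u,z)(ψ,φ) = 0` for all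
`{ψ,φ} ∈ V × V`. -/
def IsStationary (J : W D → ℝ) (u z : V D) : Prop :=
  ∀ ψ φ : V D, HasDerivAt
    (fun s : ℝ => lagrangian J (V.toW u + s • V.toW ψ) (z + s • φ)) 0 0

/-- The stabilized discrete primal problem
`A(u)(φ) + S(u)(φ) + (u_0^+, φ_0^+) = F(φ) + (u₀, φ_0^+)` for all `φ`. -/
def SolvesPrimal (u : DG D) : Prop :=
  ∀ φ : DG D, A (DG.toBroken u) (DG.toBroken φ) + S u φ
      + inner ℝ (DG.toBroken u).initial (DG.toBroken φ).initial
    = F (DG.toBroken φ) + inner ℝ (incl P.Ω P.u₀) (DG.toBroken φ).initial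

/-- The stabilized discrete dual problem
`A*(z)(ψ) + S*(z)(ψ) + (z_N^-, ψ_N^-) = J'(u_{τh})(ψ)` for all `ψ`, where `J'(u_{τh})` is
represented by `j(u_{τh})`. -/
def SolvesDual (J : W D → ℝ) (j : W D → Lp (L2 P.Ω) 2 (volume.restrict P.I)) (u z : DG D) : Prop :=
  ∀ ψ : DG D, ADual (DG.toBroken z) (DG.toBroken ψ) + SDual (j u.toW) z ψ
      + inner ℝ (DG.toBroken z).final (DG.toBroken ψ).final
    = fderiv ℝ J u.toW ψ.toW

/-- The primal residual `ρ(u_{τh})(φ) = F(φ) - A(u_{τh})(φ) - (u_{τh,0}^+ - u₀, φ(0))`. -/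
def rho (u : DG D) (φ : W D) : ℝ :=
  F φ.toBroken - A (DG.toBroken u) φ.toBroken
    - inner ℝ ((DG.toBroken u).initial - incl P.Ω P.u₀) φ.toBroken.initial

/-- The dual residual `ρ*(z_{τh})(ψ) = J'(u_{τh})(ψ) - A*(z_{τh})(ψ) - (z_{τh,N}^-, ψ(T))`. -/
def rhoDual (J : W D → ℝ) (u z : DG D) (ψ : W D) : ℝ :=
  fderiv ℝ J u.toW ψ - ADual (DG.toBroken z) ψ.toBroken
    - inner ℝ (DG.toBroken z).final ψ.toBroken.final

end Forms

end DWR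

end

open DWR

/-! Put e = u - u_τh and q = z - z_τh. By the discrete equations the residuals equal the
stabilization terms on discrete functions (`SolvesPrimal.rho_eq`, `SolvesDual.rhoDual_eq`).
Exchanging φ_τh for z_τh and ψ_τh for u_τh therefore produces exactly the terms S and S*, and what
remains is ρ*(e) = ρ(q) + Δρ_J.

Write B(v,w) = A(v)(w) + (v_0^+, w_0^+). Then ρ(q) = B(e,q) because u solves the primal equation,
J'(u)(e) = B(e,z) by the dual equation, and ρ*(e) = J'(u_τh)(e) - B(e,z_τh) by the duality of A and
A* (`A_eq_ADual`). Hence ρ*(e) - ρ(q) = J'(u_τh)(e) - J'(u)(e), which is -∫ J'' by the fundamental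
theorem of calculus (`integral_fderiv_fderiv`).

The difficulty is that e and q may jump at the nodes, while stationarity is given only for
variations in V. The products η(t)c with smooth η and c ∈ H^1_0 do lie in V. The fundamental lemma
of the calculus of variations localizes an equation tested with them to almost every t and detaches
the initial or final term (`eq_zero_of_tensor`). The localized equation can then be tested with
anything that is slabwise a finite sum of such products, in particular with V_τh
(`IsStationary.primal_slabSmooth`, `IsStationary.dual_slabSmooth`). In the dual case the time
derivative must first be moved onto z, and J'(u) must have a density in time, which is the role of
j.

Integration by parts in time is needed only when one factor is slabwise smooth, never between two
general elements of V. It reduces to the scalar functions (v(t),c), hence to the lemma of du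
Bois-Reymond (`SlabRegular.timeParts`, `V.slabRegular`). In space, the dual form is the transpose of
a because b is divergence free (`Problem.conv_antisymm`). -/

noncomputable section

namespace DWR

/-! ### The spatial form as a bounded bilinear form -/

section SpatialForm

variable {d : ℕ} {Ω : Set (Pt d)}

/-- The members of `H^1_0(Ω)` given by test functions. -/
def ofTest (Ω : Set (Pt d)) : testGraph Ω → H10 Ω :=
  inclusion (testGraph Ω).le_topologicalClosure

theorem denseRange_ofTest (Ω : Set (Pt d)) : DenseRange (ofTest Ω) :=
  (denseRange_inclusion_iff (testGraph Ω).le_topologicalClosure).2 subset_rfl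

theorem exists_test_of_ofTest (y : testGraph Ω) : ∃ φ : Pt d → ℝ, ContDiff ℝ ∞ φ ∧
    HasCompactSupport φ ∧ tsupport φ ⊆ Ω ∧ (incl Ω (ofTest Ω y) =ᵐ[volume.restrict Ω] φ) ∧
      (grad Ω (ofTest Ω y) =ᵐ[volume.restrict Ω] gradient φ) :=
  y.2

theorem gradient_mul {φ χ : Pt d → ℝ} {x : Pt d} (hφ : DifferentiableAt ℝ φ x)
    (hχ : DifferentiableAt ℝ χ x) :
    gradient (φ * χ) x = φ x • gradient χ x + χ x • gradient φ x := by
  simp only [gradient, Pi.mul_def]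
  rw [fderiv_fun_mul hφ hχ, map_add, map_smul, map_smul]

variable (P : Problem d)

/-- `v ↦ b·v` from `L²(Ω)^d` to `L²(Ω)`. -/
def Problem.innerB : L2Vec P.Ω →L[ℝ] L2 P.Ω :=
  (innerSL ℝ).holderL (volume.restrict P.Ω) ∞ 2 2 P.memLp_b.toLp

/-- `v ↦ αv` on `L²(Ω)`. -/
def Problem.mulα : L2 P.Ω →L[ℝ] L2 P.Ω :=
  (ContinuousLinearMap.mul ℝ ℝ).holderL (volume.restrict P.Ω) ∞ 2 2 P.memLp_α.toLp

theorem Problem.coeFn_innerB (v : L2Vec P.Ω) :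
    P.innerB v =ᵐ[volume.restrict P.Ω] fun x => inner ℝ (P.b x) (v x) := by
  filter_upwards [ContinuousLinearMap.coeFn_holder (r := 2) (innerSL ℝ) P.memLp_b.toLp v,
    P.memLp_b.coeFn_toLp] with x h1 h2
  refine h1.trans ?_
  rw [h2]
  rfl

theorem Problem.coeFn_mulα (v : L2 P.Ω) :
    P.mulα v =ᵐ[volume.restrict P.Ω] fun x => P.α x * v x := by
  filter_upwards [ContinuousLinearMap.coeFn_holder (r := 2) (ContinuousLinearMap.mul ℝ ℝ)
    P.memLp_α.toLp v, P.memLp_α.coeFn_toLp] with x h1 h2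
  refine h1.trans ?_
  rw [h2]
  rfl

theorem L2_inner_eq_integral_mul (v w : L2 Ω) : inner ℝ v w = ∫ x in Ω, v x * w x := by
  rw [L2.inner_def]
  exact integral_congr_ae (Eventually.of_forall fun x => by simp [mul_comm])

/-- As an `L2` inner product the convection term is visibly continuous in both arguments, which the
density argument and the bounded form below rely on. -/
theorem Problem.integral_conv (v w : H10 P.Ω) :
    ∫ x in P.Ω, inner ℝ (P.b x) (grad P.Ω v x) * incl P.Ω w x
      = inner ℝ (P.innerB (grad P.Ω v)) (incl P.Ω w) := by
  rw [L2_inner_eq_integral_mul]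
  refine integral_congr_ae ?_
  filter_upwards [P.coeFn_innerB (grad P.Ω v)] with x hx
  rw [hx]

theorem Problem.integral_react (v w : H10 P.Ω) :
    ∫ x in P.Ω, P.α x * incl P.Ω v x * incl P.Ω w x
      = inner ℝ (P.mulα (incl P.Ω v)) (incl P.Ω w) := by
  rw [L2_inner_eq_integral_mul]
  refine integral_congr_ae ?_
  filter_upwards [P.coeFn_mulα (incl P.Ω v)] with x hx
  rw [hx]

/-- Since `b` is divergence free, `(b·∇v,w) = -(b·∇w,v)` on `H^1_0(Ω)`. -/
theorem Problem.conv_antisymm (v w : H10 P.Ω) :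
    (inner ℝ (P.innerB (grad P.Ω v)) (incl P.Ω w) : ℝ)
      = -inner ℝ (P.innerB (grad P.Ω w)) (incl P.Ω v) := by
  refine (denseRange_ofTest P.Ω).induction_on₂ (p := fun v w =>
    (inner ℝ (P.innerB (grad P.Ω v)) (incl P.Ω w) : ℝ)
      = -inner ℝ (P.innerB (grad P.Ω w)) (incl P.Ω v)) ?_ (fun y y' => ?_) v w
  -- Both sides are continuous on H^1_0 × H^1_0, so test functions suffice.
  · refine isClosed_eq ?_ ?_
    · exact Continuous.inner (by fun_prop) (by fun_prop)
    · exact (Continuous.inner (by fun_prop) (by fun_prop)).neg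
  · obtain ⟨φ, h1, h2, h3, h4, h5⟩ := exists_test_of_ofTest y
    obtain ⟨χ, k1, k2, k3, k4, k5⟩ := exists_test_of_ofTest y'
    -- The gradient of φχ splits by the product rule into the integrands of the two sides.
    have hdiv := P.div_b (φ * χ) (h1.mul k1) h2.mul_right
      ((tsupport_mul_subset_left).trans h3)
    rw [← add_eq_zero_iff_eq_neg, L2.inner_def, L2.inner_def,
      ← integral_add (L2.integrable_inner _ _) (L2.integrable_inner _ _), ← hdiv]
    refine integral_congr_ae ?_
    filter_upwards [P.coeFn_innerB (grad P.Ω (ofTest P.Ω y)),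
      P.coeFn_innerB (grad P.Ω (ofTest P.Ω y')), h4, h5, k4, k5] with x e1 e2 e3 e4 e5 e6
    rw [e1, e2, e3, e4, e5, e6, gradient_mul (h1.differentiable (by simp) x)
      (k1.differentiable (by simp) x), inner_add_right, real_inner_smul_right,
      real_inner_smul_right]
    simp only [RCLike.inner_apply, conj_trivial]
    ring

/-- The spatial form `a` as a bounded bilinear form. -/
def Problem.form : H10 P.Ω →L[ℝ] H10 P.Ω →L[ℝ] ℝ :=
  P.ε • pivotEmb (grad P.Ω)
    + (pivotEmb (ContinuousLinearMap.id ℝ (L2 P.Ω))).bilinearComp (P.innerB.comp (grad P.Ω))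
        (incl P.Ω)
    + (pivotEmb (ContinuousLinearMap.id ℝ (L2 P.Ω))).bilinearComp (P.mulα.comp (incl P.Ω))
        (incl P.Ω)

theorem Problem.a_eq_form (v w : H10 P.Ω) : P.a v w = P.form v w := by
  rw [Problem.a, P.integral_conv, P.integral_react]
  rfl

theorem Problem.mulα_symm (v w : L2 P.Ω) :
    (inner ℝ (P.mulα v) w : ℝ) = inner ℝ (P.mulα w) v := by
  rw [L2_inner_eq_integral_mul, L2_inner_eq_integral_mul]
  refine integral_congr_ae ?_
  filter_upwards [P.coeFn_mulα v, P.coeFn_mulα w] with x h1 h2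
  rw [h1, h2]
  ring

/-- Diffusion and reaction are symmetric and convection is skew, so the change of sign in the
convection term amounts to transposition. -/
theorem Problem.aDual_eq_form (v w : H10 P.Ω) : P.aDual v w = P.form w v := by
  rw [← P.a_eq_form, Problem.a, Problem.aDual, P.integral_conv, P.integral_conv,
    P.integral_react, P.integral_react, P.conv_antisymm w v, P.mulα_symm (incl P.Ω w),
    real_inner_comm (grad P.Ω w), sub_eq_add_neg]

end SpatialForm

/-! ### Weak derivatives of scalar functions on an interval -/

section WeakDerivative

theorem setIntegral_Ioc_eq_of_support {T : ℝ} {g : ℝ → ℝ} (h : Function.support g ⊆ Ioo 0 T) :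
    ∫ t in Ioc 0 T, g t = ∫ t, g t :=
  setIntegral_eq_integral_of_forall_compl_eq_zero fun x hx => by
    by_contra h0
    exact hx (Ioo_subset_Ioc_self (h h0))

/-- A test function of integral zero is the derivative of a test function. -/
theorem exists_test_deriv_eq {T : ℝ} {ψ : ℝ → ℝ} (h1 : ContDiff ℝ ∞ ψ)
    (h2 : HasCompactSupport ψ) (h3 : tsupport ψ ⊆ Ioo 0 T) (h4 : ∫ t, ψ t = 0) :
    ∃ η : ℝ → ℝ, ContDiff ℝ ∞ η ∧ HasCompactSupport η ∧ tsupport η ⊆ Ioo 0 T ∧ deriv η = ψ := by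
  -- The zero function is treated apart, since the extreme points a and b of the support are used
  -- below.
  rcases (tsupport ψ).eq_empty_or_nonempty with he | hne
  · have h0 : ψ = 0 := tsupport_eq_empty_iff.1 he
    exact ⟨0, contDiff_const, HasCompactSupport.zero, by simp, by rw [h0]; funext x; simp⟩
  obtain ⟨a, haK, ha⟩ := IsCompact.exists_isLeast h2 hne
  obtain ⟨b, hbK, hb⟩ := IsCompact.exists_isGreatest h2 hne
  have hsub : Function.support ψ ⊆ Icc a b := fun x hx =>
    ⟨ha (subset_tsupport ψ hx), hb (subset_tsupport ψ hx)⟩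
  have hderiv : ∀ x, HasDerivAt (fun x => ∫ y in (0 : ℝ)..x, ψ y) (ψ x) x := fun x =>
    intervalIntegral.integral_hasDerivAt_right (h1.continuous.intervalIntegrable _ _)
      h1.continuous.stronglyMeasurable.stronglyMeasurableAtFilter h1.continuous.continuousAt
  have hd : deriv (fun x => ∫ y in (0 : ℝ)..x, ψ y) = ψ := funext fun x => (hderiv x).deriv
  -- Left of a the primitive integrates zeros; right of b it equals the total integral of ψ, which
  -- is zero.
  have hts : tsupport (fun x => ∫ y in (0 : ℝ)..x, ψ y) ⊆ Icc a b := by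
    refine closure_minimal (fun x hx => ?_) isClosed_Icc
    by_contra hxab
    refine hx ?_
    rcases lt_or_ge x a with hxa | hxa
    · refine (intervalIntegral.integral_congr (g := fun _ => (0 : ℝ)) fun y hy => ?_).trans
        intervalIntegral.integral_zero
      by_contra hy0
      have hya := (hsub hy0).1
      rcases mem_uIcc.1 hy with hy | hy
      · exact absurd hy.2 (by linarith)
      · exact absurd hy.2 (by linarith [(h3 haK).1])
    · have hxb : b < x := by
        by_contra hxb
        exact hxab ⟨hxa, not_lt.1 hxb⟩
      have hs : Function.support ψ ⊆ Ioc 0 x := fun y hy =>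
        ⟨(h3 haK).1.trans_le (hsub hy).1, (hsub hy).2.trans hxb.le⟩
      show ∫ y in (0 : ℝ)..x, ψ y = 0
      rw [intervalIntegral.integral_eq_integral_of_support_subset hs, h4]
  refine ⟨fun x => ∫ y in (0 : ℝ)..x, ψ y, ?_, ?_, ?_, hd⟩
  · exact contDiff_infty_iff_deriv.2 ⟨fun x => (hderiv x).differentiableAt, by rwa [hd]⟩
  · exact isCompact_Icc.of_isClosed_subset (isClosed_tsupport _) hts
  · exact hts.trans fun x hx => ⟨(h3 haK).1.trans_le hx.1, hx.2.trans_lt (h3 hbK).2⟩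

/-- The lemma of du Bois-Reymond: a continuous function with vanishing weak derivative is
constant. -/
theorem eq_of_weakDeriv_eq_zero {T : ℝ} (hT : 0 < T) {c : ℝ → ℝ} (hc : ContinuousOn c (Icc 0 T))
    (hw : ∀ η : ℝ → ℝ, ContDiff ℝ ∞ η → HasCompactSupport η → tsupport η ⊆ Ioo 0 T →
      ∫ t in Ioc 0 T, deriv η t * c t = 0) {s t : ℝ} (hs : s ∈ Icc 0 T) (ht : t ∈ Icc 0 T) :
    c s = c t := by
  -- A bump supported in [T/4, 3T/4], normalized to integral 1. For every test function φ, the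
  -- function φ - (∫φ)χ has integral zero and so is the derivative of a test function.
  let β : ContDiffBump (T / 2) := ⟨T / 8, T / 4, by linarith, by linarith⟩
  set χ : ℝ → ℝ := β.normed volume with hχ
  have k1 : ContDiff ℝ ∞ χ := β.contDiff_normed
  have k2 : HasCompactSupport χ := β.hasCompactSupport_normed
  have k3 : tsupport χ ⊆ Ioo 0 T := by
    rw [hχ, β.tsupport_normed_eq, Real.closedBall_eq_Icc]
    intro x hx
    have e : β.rOut = T / 4 := rfl
    rw [e] at hx
    exact ⟨by linarith [hx.1], by linarith [hx.2]⟩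
  have k4 : ∫ t, χ t = 1 := β.integral_normed
  have hint : ∀ φ : ℝ → ℝ, Continuous φ → IntegrableOn (fun t => φ t * c t) (Ioc 0 T) :=
    fun φ hφ => ((hφ.continuousOn.mul hc).integrableOn_Icc).mono_set Ioc_subset_Icc_self
  -- The value of the constant: applying the hypothesis to φ - (∫φ)χ gives ∫ φ(c - m) = 0.
  set m := ∫ t in Ioc 0 T, χ t * c t with hm
  have hae : ∀ᵐ x, x ∈ Ioo 0 T → c x - m = 0 := by
    refine isOpen_Ioo.ae_eq_zero_of_integral_contDiff_smul_eq_zero ?_ fun φ h1 h2 h3 => ?_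
    · exact ((hc.sub continuousOn_const).mono Ioo_subset_Icc_self).locallyIntegrableOn
        measurableSet_Ioo
    · have h1' : ContDiff ℝ ∞ φ := h1
      obtain ⟨η, e1, e2, e3, e4⟩ := exists_test_deriv_eq (T := T) (ψ := φ - (∫ t, φ t) • χ)
        (h1'.sub (k1.const_smul (∫ t, φ t))) (h2.sub (k2.smul_left (f := fun _ => ∫ t, φ t)))
        ((tsupport_sub _ _).trans (union_subset h3
          ((tsupport_smul_subset_right (fun _ => ∫ t, φ t) χ).trans k3))) (by
          simp only [Pi.sub_apply, Pi.smul_apply, smul_eq_mul]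
          rw [integral_sub (h1'.continuous.integrable_of_hasCompactSupport h2)
            ((k1.continuous.integrable_of_hasCompactSupport k2).const_mul _),
            integral_const_mul, k4, mul_one, sub_self])
      have h0 := hw η e1 e2 e3
      rw [e4] at h0
      have hsupp : Function.support (fun t => φ t • (c t - m)) ⊆ Ioo 0 T := fun x hx =>
        h3 (subset_tsupport φ fun h => hx (by simp [h]))
      rw [← setIntegral_Ioc_eq_of_support hsupp]
      have hφT : ∫ t in Ioc 0 T, φ t = ∫ t, φ t :=
        setIntegral_Ioc_eq_of_support ((subset_tsupport φ).trans h3)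
      have i1 := hint φ h1'.continuous
      have i2 := hint χ k1.continuous
      simp only [Pi.sub_apply, Pi.smul_apply, smul_eq_mul, sub_mul, mul_assoc] at h0
      rw [integral_sub i1 (i2.const_mul _), integral_const_mul, ← hm] at h0
      simp only [smul_eq_mul, mul_sub]
      rw [integral_sub i1 ((h1'.continuous.integrable_of_hasCompactSupport h2).integrableOn.mul_const
        m), integral_mul_const, hφT]
      exact h0
  -- Continuity upgrades the equality from almost everywhere in the open interval to all of [0,T],
  -- endpoints included.
  have hEq : EqOn c (fun _ => m) (Icc 0 T) := by
    refine Measure.eqOn_Icc_of_ae_eq volume hT.ne ?_ hc continuousOn_const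
    rw [Measure.restrict_congr_set Ioo_ae_eq_Icc.symm, EventuallyEq, ae_restrict_iff' measurableSet_Ioo]
    filter_upwards [hae] with x hx hxm
    exact sub_eq_zero.1 (hx hxm)
  rw [hEq hs, hEq ht]

/-- A continuous function on `[0,T]` is the primitive of its integrable weak derivative. -/
theorem integral_weakDeriv {T : ℝ} (hT : 0 < T) {h k : ℝ → ℝ} (hh : ContinuousOn h (Icc 0 T))
    (hk : IntegrableOn k (Ioc 0 T))
    (hw : ∀ η : ℝ → ℝ, ContDiff ℝ ∞ η → HasCompactSupport η → tsupport η ⊆ Ioo 0 T →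
      ∫ t in Ioc 0 T, deriv η t * h t = -∫ t in Ioc 0 T, η t * k t)
    {s t : ℝ} (hs : 0 ≤ s) (hst : s ≤ t) (ht : t ≤ T) : ∫ x in Ioc s t, k x = h t - h s := by
  have hkI : IntervalIntegrable k volume 0 T :=
    (intervalIntegrable_iff_integrableOn_Ioc_of_le hT.le).2 hk
  have hH := hkI.absolutelyContinuousOnInterval_intervalIntegral (c := 0) left_mem_uIcc
  have hHc : ContinuousOn (fun x => ∫ y in (0 : ℝ)..x, k y) (Icc 0 T) := by
    have := hH.continuousOn
    rwa [uIcc_of_le hT.le] at this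
  -- The difference of h and the primitive of k has weak derivative zero.
  have key := eq_of_weakDeriv_eq_zero hT (hh.sub hHc) (fun η h1 h2 h3 => ?_)
    (s := s) (t := t) ⟨hs, hst.trans ht⟩ ⟨hs.trans hst, ht⟩
  · have hadd := intervalIntegral.integral_add_adjacent_intervals (a := 0) (b := s) (c := t)
      (hkI.mono_set (by
        rw [uIcc_of_le hs, uIcc_of_le hT.le]; exact Icc_subset_Icc_right (hst.trans ht)))
      (hkI.mono_set (by
        rw [uIcc_of_le hst, uIcc_of_le hT.le]; exact Icc_subset_Icc hs ht))
    rw [← intervalIntegral.integral_of_le hst]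
    simp only [Pi.sub_apply] at key
    linarith
  -- The primitive of the merely integrable k is absolutely continuous, which is enough for
  -- integration by parts. The boundary terms vanish because η(T) = 0 and the primitive starts at 0.
  · have hη : AbsolutelyContinuousOnInterval η 0 T :=
      (h1.of_le (mod_cast le_top)).contDiffOn.absolutelyContinuousOnInterval
    have hdη := h1.continuous_deriv (by simp)
    have hparts := hH.integral_mul_deriv_eq_deriv_mul hη
    have h00 : η T = 0 := by
      by_contra h0
      exact lt_irrefl _ (h3 (subset_tsupport η h0)).2
    have hHd : ∫ x in (0 : ℝ)..T, deriv (fun x => ∫ y in (0 : ℝ)..x, k y) x * η x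
        = ∫ x in (0 : ℝ)..T, η x * k x := by
      refine intervalIntegral.integral_congr_ae ?_
      filter_upwards [hkI.ae_hasDerivAt_integral] with x hx hxT
      rw [(hx (uIoc_subset_uIcc hxT) 0 left_mem_uIcc).deriv, mul_comm]
    rw [h00, hHd, intervalIntegral.integral_same, intervalIntegral.integral_of_le hT.le,
      intervalIntegral.integral_of_le hT.le] at hparts
    have i1 : IntegrableOn (fun x => deriv η x * h x) (Ioc 0 T) :=
      ((hdη.continuousOn.mul hh).integrableOn_Icc).mono_set Ioc_subset_Icc_self
    have i2 : IntegrableOn (fun x => deriv η x * ∫ y in (0 : ℝ)..x, k y) (Ioc 0 T) :=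
      ((hdη.continuousOn.mul hHc).integrableOn_Icc).mono_set Ioc_subset_Icc_self
    simp only [Pi.sub_apply, mul_sub]
    rw [integral_sub i1 i2, hw η h1 h2 h3]
    simp only [mul_comm (∫ y in (0 : ℝ)..(_ : ℝ), k y)] at hparts
    rw [hparts, intervalIntegral.integral_of_le hT.le]
    ring

/-- Integration by parts for a continuous function with integrable weak derivative and a smooth
function. -/
theorem integral_weakDeriv_mul {T : ℝ} (hT : 0 < T) {h k : ℝ → ℝ}
    (hh : ContinuousOn h (Icc 0 T)) (hk : IntegrableOn k (Ioc 0 T))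
    (hw : ∀ η : ℝ → ℝ, ContDiff ℝ ∞ η → HasCompactSupport η → tsupport η ⊆ Ioo 0 T →
      ∫ t in Ioc 0 T, deriv η t * h t = -∫ t in Ioc 0 T, η t * k t)
    {η : ℝ → ℝ} (hη : ContDiff ℝ ∞ η)
    {s t : ℝ} (hs : 0 ≤ s) (hst : s ≤ t) (ht : t ≤ T) :
    ∫ x in Ioc s t, (η x * k x + deriv η x * h x) = η t * h t - η s * h s := by
  have hdη := hη.continuous_deriv (by simp)
  have hbk : ∀ {g : ℝ → ℝ}, Continuous g → IntegrableOn (fun x => g x * k x) (Ioc 0 T) := by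
    intro g hg
    obtain ⟨C, hC⟩ := (isCompact_Icc (a := 0) (b := T)).exists_bound_of_continuousOn
      hg.continuousOn
    refine Integrable.bdd_mul (c := C) hk hg.aestronglyMeasurable ?_
    filter_upwards [ae_restrict_mem measurableSet_Ioc] with x hx
    exact hC x (Ioc_subset_Icc_self hx)
  have hbh : ∀ {g : ℝ → ℝ}, Continuous g → IntegrableOn (fun x => g x * h x) (Ioc 0 T) :=
    fun hg => ((hg.continuousOn.mul hh).integrableOn_Icc).mono_set Ioc_subset_Icc_self
  -- The product ηh has weak derivative ηk + η'h: testing it with ξ is testing h with ξη.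
  refine integral_weakDeriv hT (h := fun x => η x * h x) (hη.continuous.continuousOn.mul hh)
    ((hbk hη.continuous).add (hbh hdη)) (fun ξ h1 h2 h3 => ?_) hs hst ht
  have hdξ := h1.continuous_deriv (by simp)
  have hprod := hw (ξ * η) (h1.mul hη) h2.mul_right (tsupport_mul_subset_left.trans h3)
  have e : ∀ x, deriv (ξ * η) x = deriv ξ x * η x + ξ x * deriv η x := fun x =>
    deriv_mul (h1.differentiable (by simp) x) (hη.differentiable (by simp) x)
  have i1 := hbh (g := fun x => deriv ξ x * η x) (hdξ.mul hη.continuous)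
  have i2 := hbh (g := fun x => ξ x * deriv η x) (h1.continuous.mul hdη)
  have i3 := hbk (g := fun x => ξ x * η x) (h1.continuous.mul hη.continuous)
  simp only [e, add_mul, Pi.mul_apply] at hprod
  rw [integral_add i1 i2] at hprod
  simp only [Pi.add_apply, mul_add, ← mul_assoc]
  rw [integral_add i3 i2]
  linarith

end WeakDerivative

/-! ### The forms `A`, `A*` and `F` through the space-time duality pairing -/

section TimeForms

variable {d : ℕ} {P : Problem d} {D : Discretization P}

theorem Discretization.slab_subset (D : Discretization P) (n : Fin (D.M + 1)) :
    D.slab n ⊆ P.I := by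
  refine Ioc_subset_Ioc ?_ ?_
  · rw [← D.node_zero]
    exact D.node_strictMono.monotone (Fin.zero_le _)
  · rw [← D.node_last]
    exact D.node_strictMono.monotone (Fin.le_last _)

theorem Discretization.node_mem (D : Discretization P) (i : Fin (D.M + 2)) :
    D.node i ∈ Icc 0 P.T := by
  rw [← D.node_zero, ← D.node_last]
  exact ⟨D.node_strictMono.monotone (Fin.zero_le _), D.node_strictMono.monotone (Fin.le_last _)⟩

theorem Discretization.node_le (D : Discretization P) (n : Fin (D.M + 1)) :
    D.node n.castSucc ≤ D.node n.succ :=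
  D.node_strictMono.monotone (Fin.castSucc_lt_succ).le

theorem sum_integral_Ioc {M : ℕ} (x : Fin (M + 2) → ℝ) (hx : Monotone x) {g : ℝ → ℝ}
    (hg : IntegrableOn g (Ioc (x 0) (x (Fin.last (M + 1))))) :
    ∑ n : Fin (M + 1), ∫ t in Ioc (x n.castSucc) (x n.succ), g t
      = ∫ t in Ioc (x 0) (x (Fin.last (M + 1))), g t := by
  induction M with
  | zero => simp
  | succ M ih =>
    have h1 : x 0 ≤ x (Fin.last (M + 1)).castSucc := hx (Fin.zero_le _)
    have h2 : x (Fin.last (M + 1)).castSucc ≤ x (Fin.last (M + 2)) := hx (Fin.le_last _)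
    rw [Fin.sum_univ_castSucc]
    have := ih (fun i => x i.castSucc) (hx.comp (Fin.strictMono_castSucc).monotone)
      (hg.mono_set (Ioc_subset_Ioc_right h2))
    simp only [Fin.succ_castSucc]
    rw [this, Fin.succ_last, Fin.castSucc_zero, ← Ioc_union_Ioc_eq_Ioc h1 h2, setIntegral_union
      (Ioc_disjoint_Ioc_of_le le_rfl) measurableSet_Ioc
      (hg.mono_set (Ioc_subset_Ioc_right h2)) (hg.mono_set (Ioc_subset_Ioc_left h1))]

theorem Discretization.sum_slab (D : Discretization P) {g : ℝ → ℝ} (hg : IntegrableOn g P.I) :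
    ∑ n, ∫ t in D.slab n, g t = ∫ t in P.I, g t := by
  have e : P.I = Ioc (D.node 0) (D.node (Fin.last (D.M + 1))) := by
    rw [D.node_zero, D.node_last]
  rw [e] at hg ⊢
  exact sum_integral_Ioc D.node D.node_strictMono.monotone hg

/-- The duality pairing of `L²(I;H^{-1}(Ω))` and `L²(I;H^1_0(Ω))`. -/
def pairing (P : Problem d) : Lp (Hneg P.Ω) 2 (volume.restrict P.I) →L[ℝ]
    Lp (H10 P.Ω) 2 (volume.restrict P.I) →L[ℝ] ℝ :=
  (ContinuousLinearMap.id ℝ (Hneg P.Ω)).lpPairing (volume.restrict P.I) 2 2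

theorem pairing_apply (G : Lp (Hneg P.Ω) 2 (volume.restrict P.I))
    (φ : Lp (H10 P.Ω) 2 (volume.restrict P.I)) : pairing P G φ = ∫ t in P.I, G t (φ t) :=
  ContinuousLinearMap.lpPairing_eq_integral _ _ _

theorem integrable_pairing (G : Lp (Hneg P.Ω) 2 (volume.restrict P.I))
    (φ : Lp (H10 P.Ω) 2 (volume.restrict P.I)) : IntegrableOn (fun t => G t (φ t)) P.I :=
  memLp_one_iff_integrable.1
    ((ContinuousLinearMap.id ℝ (Hneg P.Ω)).memLp_of_bilin 1 (Lp.memLp G) (Lp.memLp φ))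

theorem sum_slab_pairing (D : Discretization P) (G : Lp (Hneg P.Ω) 2 (volume.restrict P.I))
    (φ : Lp (H10 P.Ω) 2 (volume.restrict P.I)) :
    ∑ n, ∫ t in D.slab n, G t (φ t) = pairing P G φ := by
  rw [pairing_apply, D.sum_slab (integrable_pairing G φ)]

theorem ae_slab {p : ℝ → Prop} (h : ∀ᵐ t ∂(volume.restrict P.I), p t) (n : Fin (D.M + 1)) :
    ∀ᵐ t ∂(volume.restrict (D.slab n)), p t :=
  ae_restrict_of_ae_restrict_of_subset (D.slab_subset n) h

/-- `v ↦ a(v)(·)` as a map from `L²(I;H^1_0(Ω))` to `L²(I;H^{-1}(Ω))`. -/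
def formL (P : Problem d) : Lp (H10 P.Ω) 2 (volume.restrict P.I) →L[ℝ]
    Lp (Hneg P.Ω) 2 (volume.restrict P.I) :=
  P.form.compLpL 2 (volume.restrict P.I)

/-- `v ↦ a(·)(v)` as a map from `L²(I;H^1_0(Ω))` to `L²(I;H^{-1}(Ω))`. -/
def formDualL (P : Problem d) : Lp (H10 P.Ω) 2 (volume.restrict P.I) →L[ℝ]
    Lp (Hneg P.Ω) 2 (volume.restrict P.I) :=
  P.form.flip.compLpL 2 (volume.restrict P.I)

/-- The embedding `L²(Ω) → H^{-1}(Ω)`. -/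
def l2Dual (Ω : Set (Pt d)) : L2 Ω →L[ℝ] Hneg Ω :=
  (pivotEmb (ContinuousLinearMap.id ℝ (L2 Ω))).bilinearComp (ContinuousLinearMap.id ℝ (L2 Ω))
    (incl Ω)

theorem l2Dual_apply {Ω : Set (Pt d)} (y : L2 Ω) (v : H10 Ω) :
    l2Dual Ω y v = inner ℝ y (incl Ω v) :=
  rfl

/-- The embedding `L²(I;L²(Ω)) → L²(I;H^{-1}(Ω))`. -/
def l2DualL (P : Problem d) : Lp (L2 P.Ω) 2 (volume.restrict P.I) →L[ℝ]
    Lp (Hneg P.Ω) 2 (volume.restrict P.I) :=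
  (l2Dual P.Ω).compLpL 2 (volume.restrict P.I)

theorem pairing_l2DualL (g : Lp (L2 P.Ω) 2 (volume.restrict P.I))
    (φ : Lp (H10 P.Ω) 2 (volume.restrict P.I)) :
    pairing P (l2DualL P g) φ = ∫ t in P.I, inner ℝ (g t) (incl P.Ω (φ t)) := by
  rw [pairing_apply]
  refine integral_congr_ae ?_
  filter_upwards [(l2Dual P.Ω).coeFn_compLpL g] with t ht
  rw [← l2Dual_apply, ← ht]
  rfl

/-- The spatial half of the duality between A and A*. -/
theorem pairing_formL_comm (v w : Lp (H10 P.Ω) 2 (volume.restrict P.I)) :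
    pairing P (formL P v) w = pairing P (formDualL P w) v := by
  rw [pairing_apply, pairing_apply]
  refine integral_congr_ae ?_
  filter_upwards [P.form.coeFn_compLpL v, P.form.flip.coeFn_compLpL w] with t h1 h2
  rw [formL, formDualL, h1, h2]
  rfl

theorem F_eq_pairing (φ : Broken D) : F φ = pairing P (l2DualL P P.f) φ.1 := by
  rw [pairing_l2DualL]
  rfl

/-- Merging the slab integrals into one bounded bilinear pairing settles integrability once, so that
bilinearity of A becomes formal. -/
theorem A_eq_pairing (u φ : Broken D) :
    A u φ = pairing P (u.2.1 + formL P u.1) φ.1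
      + ∑ m, inner ℝ (u.jump m) (φ.leftVal m.succ) := by
  rw [A, ← sum_slab_pairing D]
  congr 1
  refine Finset.sum_congr rfl fun n _ => integral_congr_ae (ae_slab ?_ n)
  filter_upwards [P.form.coeFn_compLpL u.1, Lp.coeFn_add u.2.1 (formL P u.1)] with t h1 h2
  rw [h2, Pi.add_apply, formL, h1, P.a_eq_form]
  rfl

theorem ADual_eq_pairing (z ψ : Broken D) :
    ADual z ψ = pairing P (-z.2.1 + formDualL P z.1) ψ.1
      - ∑ m, inner ℝ (z.jump m) (ψ.rightVal m.castSucc) := by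
  rw [ADual, ← sum_slab_pairing D]
  congr 1
  refine Finset.sum_congr rfl fun n _ => integral_congr_ae (ae_slab ?_ n)
  filter_upwards [P.form.flip.coeFn_compLpL z.1, Lp.coeFn_add (-z.2.1) (formDualL P z.1),
    Lp.coeFn_neg z.2.1] with t h1 h2 h3
  rw [h2, Pi.add_apply, h3, formDualL, h1, P.aDual_eq_form]
  rfl

/-! ### Bilinearity -/

theorem A_add_left (u v φ : Broken D) : A (u + v) φ = A u φ + A v φ := by
  have hj : ∀ m, (u + v).jump m = u.jump m + v.jump m := fun m => add_sub_add_comm _ _ _ _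
  simp only [A_eq_pairing, hj, inner_add_left, Finset.sum_add_distrib, Prod.fst_add, Prod.snd_add,
    map_add, add_apply]
  ring

theorem A_smul_left (c : ℝ) (u φ : Broken D) : A (c • u) φ = c * A u φ := by
  have hj : ∀ m, (c • u).jump m = c • u.jump m := fun m => (smul_sub c (u.leftVal m.succ) (u.rightVal m.castSucc)).symm
  simp only [A_eq_pairing, hj, real_inner_smul_left, ← Finset.mul_sum, Prod.smul_fst,
    Prod.smul_snd, map_smul, map_add, add_apply,
    smul_apply, smul_eq_mul]
  ring

theorem A_add_right (u φ χ : Broken D) : A u (φ + χ) = A u φ + A u χ := by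
  have hj : ∀ n, (φ + χ).leftVal n = φ.leftVal n + χ.leftVal n := fun n => rfl
  simp only [A_eq_pairing, hj, inner_add_right, Finset.sum_add_distrib, Prod.fst_add, map_add]
  ring

theorem A_smul_right (c : ℝ) (u φ : Broken D) : A u (c • φ) = c * A u φ := by
  have hj : ∀ n, (c • φ).leftVal n = c • φ.leftVal n := fun n => rfl
  simp only [A_eq_pairing, hj, real_inner_smul_right, ← Finset.mul_sum, Prod.smul_fst,
    map_smul, smul_eq_mul]
  ring

theorem ADual_add_right (z φ χ : Broken D) : ADual z (φ + χ) = ADual z φ + ADual z χ := by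
  have hj : ∀ n, (φ + χ).rightVal n = φ.rightVal n + χ.rightVal n := fun n => rfl
  simp only [ADual_eq_pairing, hj, inner_add_right, Finset.sum_add_distrib, Prod.fst_add, map_add]
  ring

theorem F_add (φ χ : Broken D) : F (φ + χ) = F φ + F χ := by
  simp only [F_eq_pairing, Prod.fst_add, map_add]

theorem F_smul (c : ℝ) (φ : Broken D) : F (c • φ) = c * F φ := by
  simp only [F_eq_pairing, Prod.smul_fst, map_smul, smul_eq_mul]

theorem Broken.initial_add (u v : Broken D) : (u + v).initial = u.initial + v.initial := rfl

theorem Broken.final_add (u v : Broken D) : (u + v).final = u.final + v.final := rfl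

/-! ### Duality of `A` and `A*` -/

/-- `∑ₙ ∫_{Iₙ} {(∂ₜv,w) + (v,∂ₜw)} dt = ∑ₙ {(v_n^-,w_n^-) - (v_{n-1}^+,w_{n-1}^+)}`. -/
def TimeParts (v w : Broken D) : Prop :=
  pairing P v.2.1 w.1 + pairing P w.2.1 v.1
    = ∑ n, (inner ℝ (v.rightVal n) (w.rightVal n) - inner ℝ (v.leftVal n) (w.leftVal n))

theorem TimeParts.symm {v w : Broken D} (h : TimeParts v w) : TimeParts w v := by
  unfold TimeParts at h ⊢
  rw [add_comm, h]
  simp only [real_inner_comm]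

theorem TimeParts.add_left {v v' w : Broken D} (h : TimeParts v w) (h' : TimeParts v' w) :
    TimeParts (v + v') w := by
  unfold TimeParts at h h' ⊢
  have hl : ∀ n, (v + v').leftVal n = v.leftVal n + v'.leftVal n := fun n => rfl
  have hr : ∀ n, (v + v').rightVal n = v.rightVal n + v'.rightVal n := fun n => rfl
  simp only [hl, hr, Prod.fst_add, Prod.snd_add, map_add, add_apply,
    inner_add_left, add_sub_add_comm, Finset.sum_add_distrib]
  simp only [← h, ← h']
  ring

/-- The spatial forms are transposes of each other. In time, integration by parts leaves boundary
terms on each slab; the jump terms of A and A* absorb those at interior nodes, and only t = 0 and t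
= T survive. -/
theorem A_eq_ADual {v w : Broken D} (h : TimeParts v w) :
    A v w + inner ℝ v.initial w.initial = ADual w v + inner ℝ w.final v.final := by
  unfold TimeParts at h
  rw [A_eq_pairing, ADual_eq_pairing]
  simp only [map_add, map_neg, add_apply, neg_apply,
    pairing_formL_comm v.1 w.1]
  -- Splitting off the last right end and the first left end leaves two sums over the interior
  -- nodes.
  rw [Finset.sum_sub_distrib, Fin.sum_univ_castSucc, Fin.sum_univ_succ (n := D.M)] at h
  -- At each node ([v],w⁺) + ([w],v⁻) = (v⁺,w⁺) - (v⁻,w⁻), the mixed products cancelling.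
  have hj : ∑ m : Fin D.M, (inner ℝ (v.jump m) (w.leftVal m.succ) : ℝ)
      + ∑ m : Fin D.M, inner ℝ (w.jump m) (v.rightVal m.castSucc)
      = ∑ m : Fin D.M, inner ℝ (v.leftVal m.succ) (w.leftVal m.succ)
        - ∑ m : Fin D.M, inner ℝ (v.rightVal m.castSucc) (w.rightVal m.castSucc) := by
    rw [← Finset.sum_add_distrib, ← Finset.sum_sub_distrib]
    refine Finset.sum_congr rfl fun m _ => ?_
    rw [Broken.jump, Broken.jump, inner_sub_left, inner_sub_left,
      real_inner_comm (v.rightVal m.castSucc) (w.leftVal m.succ),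
      real_inner_comm (v.rightVal m.castSucc) (w.rightVal m.castSucc)]
    ring
  have hf : (inner ℝ w.final v.final : ℝ)
      = inner ℝ (v.rightVal (Fin.last D.M)) (w.rightVal (Fin.last D.M)) := real_inner_comm _ _
  have hi : (inner ℝ v.initial w.initial : ℝ) = inner ℝ (v.leftVal 0) (w.leftVal 0) := rfl
  rw [hf, hi]
  linarith

end TimeForms

/-! ### Integration by parts in time -/

section TimeRegularity

variable {d : ℕ} {P : Problem d} {D : Discretization P}

/-- On each slab, `∂ₜv` is the weak derivative of `v` and the one-sided limits are its boundary
values: integration by parts holds against `η(t) c` with smooth `η` and `c ∈ H^1_0(Ω)`. -/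
def SlabRegular (v : Broken D) : Prop :=
  ∀ (n : Fin (D.M + 1)) (c : H10 P.Ω) (η : ℝ → ℝ), ContDiff ℝ ∞ η →
    ∫ t in D.slab n, (η t * v.dt t c + deriv η t * inner ℝ (incl P.Ω (v.val t)) (incl P.Ω c))
      = η (D.node n.succ) * inner ℝ (v.rightVal n) (incl P.Ω c)
        - η (D.node n.castSucc) * inner ℝ (v.leftVal n) (incl P.Ω c)

/-- On each slab, `w` is a finite sum of products `η(t) c` with smooth `η` and `c ∈ H^1_0(Ω)`. -/
def SlabSmooth (w : Broken D) : Prop :=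
  ∀ n : Fin (D.M + 1), ∃ (m : ℕ) (η : Fin m → ℝ → ℝ) (c : Fin m → H10 P.Ω),
    (∀ k, ContDiff ℝ ∞ (η k)) ∧
    (∀ᵐ t ∂(volume.restrict (D.slab n)), w.val t = ∑ k, η k t • c k) ∧
    (∀ᵐ t ∂(volume.restrict (D.slab n)), w.dt t = ∑ k, deriv (η k) t • dualEmb P.Ω (c k)) ∧
    w.leftVal n = ∑ k, η k (D.node n.castSucc) • incl P.Ω (c k) ∧
    w.rightVal n = ∑ k, η k (D.node n.succ) • incl P.Ω (c k)

theorem dualEmb_apply {Ω : Set (Pt d)} (v w : H10 Ω) :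
    dualEmb Ω v w = inner ℝ (incl Ω v) (incl Ω w) :=
  rfl

theorem integrableOn_continuous_mul {a b : ℝ} {k g : ℝ → ℝ} (hg : Continuous g)
    (hk : IntegrableOn k (Ioc a b)) : IntegrableOn (fun t => g t * k t) (Ioc a b) := by
  obtain ⟨C, hC⟩ := (isCompact_Icc (a := a) (b := b)).exists_bound_of_continuousOn
    hg.continuousOn
  refine Integrable.bdd_mul (c := C) hk hg.aestronglyMeasurable ?_
  filter_upwards [ae_restrict_mem measurableSet_Ioc] with x hx
  exact hC x (Ioc_subset_Icc_self hx)

theorem integrable_apply (G : Lp (Hneg P.Ω) 2 (volume.restrict P.I)) (c : H10 P.Ω) :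
    IntegrableOn (fun t => G t c) P.I :=
  (ContinuousLinearMap.apply ℝ ℝ c).integrable_comp ((Lp.memLp G).integrable (by norm_num))

theorem integrable_inner_incl (v : Lp (H10 P.Ω) 2 (volume.restrict P.I)) (c : H10 P.Ω) :
    IntegrableOn (fun t => (inner ℝ (incl P.Ω (v t)) (incl P.Ω c) : ℝ)) P.I :=
  ((dualEmb P.Ω).flip c).integrable_comp ((Lp.memLp v).integrable (by norm_num))

theorem integral_deriv_mul_add {a b : ℝ} (hab : a ≤ b) {η χ : ℝ → ℝ} (hη : ContDiff ℝ ∞ η)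
    (hχ : ContDiff ℝ ∞ χ) :
    ∫ t in Ioc a b, (η t * deriv χ t + deriv η t * χ t) = η b * χ b - η a * χ a := by
  rw [← intervalIntegral.integral_of_le hab]
  have e : ∀ t, HasDerivAt (fun t => η t * χ t) (η t * deriv χ t + deriv η t * χ t) t := by
    intro t
    rw [add_comm]
    exact (hη.differentiable (by simp) t).hasDerivAt.mul (hχ.differentiable (by simp) t).hasDerivAt
  refine intervalIntegral.integral_eq_sub_of_hasDerivAt (fun t _ => e t) ?_
  refine Continuous.intervalIntegrable ?_ _ _
  exact (hη.continuous.mul (hχ.continuous_deriv (by simp))).add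
    ((hη.continuous_deriv (by simp)).mul hχ.continuous)

/-- The classical product rule, term by term. It admits the discrete part of the error as the first
factor in the integration by parts. -/
theorem SlabSmooth.regular {w : Broken D} (hw : SlabSmooth w) : SlabRegular w := by
  intro n c η hη
  obtain ⟨m, χ, e, h1, h2, h3, h4, h5⟩ := hw n
  have hcont : ∀ k, Continuous fun t => η t * deriv (χ k) t + deriv η t * χ k t := fun k =>
    (hη.continuous.mul ((h1 k).continuous_deriv (by simp))).add
      ((hη.continuous_deriv (by simp)).mul (h1 k).continuous)
  have hI : ∫ t in D.slab n, (η t * w.dt t c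
        + deriv η t * inner ℝ (incl P.Ω (w.val t)) (incl P.Ω c))
      = ∫ t in D.slab n, ∑ k, (η t * deriv (χ k) t + deriv η t * χ k t)
        * inner ℝ (incl P.Ω (e k)) (incl P.Ω c) := by
    refine integral_congr_ae ?_
    filter_upwards [h2, h3] with t k2 k3
    rw [k2, k3]
    simp only [map_sum, sum_inner, map_smul, real_inner_smul_left, sum_apply,
      smul_apply, dualEmb_apply, smul_eq_mul, Finset.mul_sum,
      ← Finset.sum_add_distrib]
    exact Finset.sum_congr rfl fun k _ => by ring
  rw [hI, Discretization.slab, integral_finsetSum _ fun k _ => ((hcont k).integrableOn_Icc.mono_set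
    Ioc_subset_Icc_self).mul_const _, h4, h5]
  simp only [integral_mul_const, sum_inner, real_inner_smul_left, Finset.mul_sum,
    ← Finset.sum_sub_distrib]
  refine Finset.sum_congr rfl fun k _ => ?_
  rw [integral_deriv_mul_add (D.node_le n) hη (h1 k)]
  ring

/-- Since w is a finite sum of products on each slab, the regularity of v applies term by term and
no approximation in V is needed. -/
theorem SlabRegular.timeParts {v w : Broken D} (hv : SlabRegular v) (hw : SlabSmooth w) :
    TimeParts v w := by
  unfold TimeParts
  rw [← sum_slab_pairing D, ← sum_slab_pairing D, ← Finset.sum_add_distrib]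
  refine Finset.sum_congr rfl fun n _ => ?_
  rw [← integral_add ((integrable_pairing _ _).mono_set (D.slab_subset n))
    ((integrable_pairing _ _).mono_set (D.slab_subset n))]
  obtain ⟨m, χ, e, h1, h2, h3, h4, h5⟩ := hw n
  have hI : ∫ t in D.slab n, (v.2.1 t (w.1 t) + w.2.1 t (v.1 t))
      = ∫ t in D.slab n, ∑ k, (χ k t * v.dt t (e k)
        + deriv (χ k) t * inner ℝ (incl P.Ω (v.val t)) (incl P.Ω (e k))) := by
    refine integral_congr_ae ?_
    filter_upwards [h2, h3] with t k2 k3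
    have k2' : w.1 t = ∑ k, χ k t • e k := k2
    have k3' : w.2.1 t = ∑ k, deriv (χ k) t • dualEmb P.Ω (e k) := k3
    rw [k2', k3']
    simp only [map_sum, map_smul, sum_apply,
      smul_apply, dualEmb_apply, smul_eq_mul, ← Finset.sum_add_distrib]
    refine Finset.sum_congr rfl fun k _ => ?_
    rw [real_inner_comm]
    rfl
  rw [hI, integral_finsetSum _ fun k _ => ?_, h4, h5]
  · simp only [inner_sum, real_inner_smul_right, ← Finset.sum_sub_distrib]
    exact Finset.sum_congr rfl fun k _ => hv n (e k) (χ k) (h1 k)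
  · exact (integrableOn_continuous_mul (h1 k).continuous
      ((integrable_apply v.2.1 (e k)).mono_set (D.slab_subset n))).add
      (integrableOn_continuous_mul ((h1 k).continuous_deriv (by simp))
        ((integrable_inner_incl v.1 (e k)).mono_set (D.slab_subset n)))

/-- Evaluating the weak derivative identity at c makes ⟨∂ₜv, c⟩ the weak derivative of the scalar
function (g(t), c), where g is the continuous representative. The scalar result applies, and g
supplies the node values. -/
theorem V.slabRegular (v : V D) : SlabRegular (v : Broken D) := by
  obtain ⟨hw, g, hg, hvg, hgn⟩ := v.2
  intro n c η hη
  have hgc : ContinuousOn (fun t => (inner ℝ (g t) (incl P.Ω c) : ℝ)) (Icc 0 P.T) :=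
    hg.inner continuousOn_const
  have hweak : ∀ ξ : ℝ → ℝ, ContDiff ℝ ∞ ξ → HasCompactSupport ξ → tsupport ξ ⊆ Ioo 0 P.T →
      ∫ t in Ioc 0 P.T, deriv ξ t * inner ℝ (g t) (incl P.Ω c)
        = -∫ t in Ioc 0 P.T, ξ t * (v : Broken D).dt t c := by
    intro ξ h1 h2 h3
    have hI := congrArg (ContinuousLinearMap.apply ℝ ℝ c) (hw ξ h1 h2 h3)
    have i1 : IntegrableOn (fun t => deriv ξ t • dualEmb P.Ω ((v : Broken D).1 t)) P.I :=
      integrable_testFun_smul _ ((dualEmb P.Ω).comp_memLp (v : Broken D).1)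
        (h1.continuous_deriv (by simp)) h2.deriv
    have i2 : IntegrableOn (fun t => ξ t • (v : Broken D).2.1 t) P.I :=
      integrable_testFun_smul _ (Lp.memLp (v : Broken D).2.1) h1.continuous h2
    rw [map_neg, ← ContinuousLinearMap.integral_comp_comm _ i1,
      ← ContinuousLinearMap.integral_comp_comm _ i2] at hI
    refine Eq.trans (integral_congr_ae ?_) hI
    filter_upwards [hvg] with t ht
    rw [← ht]
    rfl
  have key := integral_weakDeriv_mul P.T_pos hgc (integrable_apply (v : Broken D).2.1 c) hweak hη
    (D.node_mem n.castSucc).1 (D.node_le n) (D.node_mem n.succ).2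
  rw [(hgn n).1, (hgn n).2, ← key]
  refine integral_congr_ae ?_
  filter_upwards [ae_slab hvg n] with t ht
  rw [ht]
  rfl

theorem glue_apply {Y : Type*} [AddCommMonoid Y] (D : Discretization P)
    (g : Fin (D.M + 1) → ℝ → Y) {n : Fin (D.M + 1)} {t : ℝ} (ht : t ∈ D.slab n) :
    DG.glue D g t = g n t := by
  rw [DG.glue, Finset.sum_eq_single n, indicator_of_mem ht]
  · intro k _ hk
    refine indicator_of_notMem (fun hkt => ?_) _
    rcases lt_or_gt_of_ne hk with h | h
    · exact absurd (ht.1.trans_le hkt.2) (not_lt.2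
        (D.node_strictMono.monotone (Fin.succ_le_castSucc_iff.2 h)))
    · exact absurd (hkt.1.trans_le ht.2) (not_lt.2
        (D.node_strictMono.monotone (Fin.succ_le_castSucc_iff.2 h)))
  · simp

theorem DG.slabSmooth (v : DG D) : SlabSmooth (DG.toBroken v) := by
  intro n
  refine ⟨D.r + 1, fun k t => t ^ (k : ℕ), fun k => v n k, fun k => contDiff_id.pow _,
    ?_, ?_, ?_, ?_⟩
  · filter_upwards [ae_slab v.memLp_val.coeFn_toLp n,
      ae_restrict_mem (measurableSet_Ioc : MeasurableSet (D.slab n))] with t h1 h2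
    refine h1.trans ((glue_apply D _ h2).trans ?_)
    simp [DG.slabVal]
  · filter_upwards [ae_slab v.memLp_dt.coeFn_toLp n,
      ae_restrict_mem (measurableSet_Ioc : MeasurableSet (D.slab n))] with t h1 h2
    refine h1.trans ((glue_apply D _ h2).trans ?_)
    simp [DG.slabDt]
  · show incl P.Ω (v.slabVal n _ : H10 P.Ω) = _
    simp [DG.slabVal]
  · show incl P.Ω (v.slabVal n _ : H10 P.Ω) = _
    simp [DG.slabVal]

end TimeRegularity

/-! ### Stationary points and discrete test functions -/

section Stationary

variable {d : ℕ} {P : Problem d} {D : Discretization P}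

theorem memLp_continuous_smul {Y : Type*} [NormedAddCommGroup Y] [NormedSpace ℝ Y] {T : ℝ}
    {η : ℝ → ℝ} (hη : Continuous η) (y : Y) :
    MemLp (fun t => η t • y) 2 (volume.restrict (Ioc 0 T)) := by
  have hc : Continuous fun t => η t • y := hη.smul continuous_const
  obtain ⟨C, hC⟩ := (isCompact_Icc (a := 0) (b := T)).exists_bound_of_continuousOn hc.continuousOn
  refine MemLp.of_bound hc.aestronglyMeasurable C ?_
  filter_upwards [ae_restrict_mem measurableSet_Ioc] with t ht
  exact hC t (Ioc_subset_Icc_self ht)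

/-- The function `η(t) c` with smooth `η` and `c ∈ H^1_0(Ω)`, with its time derivative and its
values at the nodes. -/
def tensor (D : Discretization P) {η : ℝ → ℝ} (hη : ContDiff ℝ ∞ η) (c : H10 P.Ω) : Broken D :=
  ((memLp_continuous_smul hη.continuous c).toLp,
    (memLp_continuous_smul (hη.continuous_deriv (by simp)) (dualEmb P.Ω c)).toLp,
    fun n => η (D.node n.castSucc) • incl P.Ω c, fun n => η (D.node n.succ) • incl P.Ω c)

theorem tensor_val (D : Discretization P) {η : ℝ → ℝ} (hη : ContDiff ℝ ∞ η) (c : H10 P.Ω) :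
    ∀ᵐ t ∂(volume.restrict P.I), (tensor D hη c).1 t = η t • c :=
  (memLp_continuous_smul hη.continuous c).coeFn_toLp

theorem tensor_dt (D : Discretization P) {η : ℝ → ℝ} (hη : ContDiff ℝ ∞ η) (c : H10 P.Ω) :
    ∀ᵐ t ∂(volume.restrict P.I), (tensor D hη c).2.1 t = deriv η t • dualEmb P.Ω c :=
  (memLp_continuous_smul (hη.continuous_deriv (by simp)) (dualEmb P.Ω c)).coeFn_toLp

theorem tensor_initial (D : Discretization P) {η : ℝ → ℝ} (hη : ContDiff ℝ ∞ η) (c : H10 P.Ω) :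
    (tensor D hη c).initial = η 0 • incl P.Ω c := by
  rw [← D.node_zero]
  rfl

theorem tensor_final (D : Discretization P) {η : ℝ → ℝ} (hη : ContDiff ℝ ∞ η) (c : H10 P.Ω) :
    (tensor D hη c).final = η P.T • incl P.Ω c := by
  rw [← D.node_last]
  rfl

/-- Smooth across every node, these products are admissible variations at a stationary point. -/
theorem tensor_mem_V (D : Discretization P) {η : ℝ → ℝ} (hη : ContDiff ℝ ∞ η) (c : H10 P.Ω) :
    tensor D hη c ∈ V D := by
  refine ⟨fun ξ h1 _ h3 => ?_, fun t => η t • incl P.Ω c,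
    (hη.continuous.smul continuous_const).continuousOn, ?_, fun n => ⟨rfl, rfl⟩⟩
  · have e1 : ∫ t in P.I, deriv ξ t • dualEmb P.Ω ((tensor D hη c).1 t)
        = ∫ t in P.I, (deriv ξ t * η t) • dualEmb P.Ω c := by
      refine integral_congr_ae ?_
      filter_upwards [tensor_val D hη c] with t ht
      rw [ht, map_smul, smul_smul]
    have e2 : ∫ t in P.I, ξ t • (tensor D hη c).2.1 t
        = ∫ t in P.I, (ξ t * deriv η t) • dualEmb P.Ω c := by
      refine integral_congr_ae ?_
      filter_upwards [tensor_dt D hη c] with t ht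
      rw [ht, smul_smul]
    have hparts := integral_deriv_mul_add P.T_pos.le h1 hη
    have h0 : ξ 0 = 0 := by
      by_contra h
      exact lt_irrefl _ (h3 (subset_tsupport ξ h)).1
    have hT : ξ P.T = 0 := by
      by_contra h
      exact lt_irrefl _ (h3 (subset_tsupport ξ h)).2
    have i1 : IntegrableOn (fun t => ξ t * deriv η t) (Ioc 0 P.T) :=
      (h1.continuous.mul (hη.continuous_deriv (by simp))).integrableOn_Icc.mono_set
        Ioc_subset_Icc_self
    have i2 : IntegrableOn (fun t => deriv ξ t * η t) (Ioc 0 P.T) :=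
      ((h1.continuous_deriv (by simp)).mul hη.continuous).integrableOn_Icc.mono_set
        Ioc_subset_Icc_self
    rw [integral_add i1 i2, h0, hT] at hparts
    rw [e1, e2, integral_smul_const, integral_smul_const, ← neg_smul]
    congr 1
    linarith
  · filter_upwards [tensor_val D hη c] with t ht
    rw [Broken.val, ht, map_smul]

/-- `η(t) c` as an element of `V`. -/
def tensorV (D : Discretization P) {η : ℝ → ℝ} (hη : ContDiff ℝ ∞ η) (c : H10 P.Ω) : V D :=
  ⟨tensor D hη c, tensor_mem_V D hη c⟩

theorem tensor_slabSmooth (D : Discretization P) {η : ℝ → ℝ} (hη : ContDiff ℝ ∞ η)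
    (c : H10 P.Ω) : SlabSmooth (tensor D hη c) := by
  intro n
  refine ⟨1, fun _ => η, fun _ => c, fun _ => hη, ?_, ?_, ?_, ?_⟩
  · filter_upwards [ae_slab (tensor_val D hη c) n] with t ht
    simpa [Broken.val] using ht
  · filter_upwards [ae_slab (tensor_dt D hη c) n] with t ht
    simpa [Broken.dt] using ht
  · simp [tensor, Broken.leftVal]
  · simp [tensor, Broken.rightVal]

theorem pairing_tensor (G : Lp (Hneg P.Ω) 2 (volume.restrict P.I)) {η : ℝ → ℝ}
    (hη : ContDiff ℝ ∞ η) (c : H10 P.Ω) :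
    pairing P G (tensor D hη c).1 = ∫ t in P.I, η t * G t c := by
  rw [pairing_apply]
  refine integral_congr_ae ?_
  filter_upwards [tensor_val D hη c] with t ht
  rw [ht, map_smul, smul_eq_mul]

/-! ### Localization of variational equations in time -/

/-- An equation tested with all `η(t) c` holds pointwise: `G(t) = 0` for almost all `t`, and
`y = 0` on `H^1_0(Ω)`. -/
theorem eq_zero_of_tensor {G : Lp (Hneg P.Ω) 2 (volume.restrict P.I)} {y : L2 P.Ω} {t₀ : ℝ}
    (ht₀ : t₀ ∉ Ioo 0 P.T)
    (h : ∀ (η : ℝ → ℝ) (_ : ContDiff ℝ ∞ η) (c : H10 P.Ω),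
      (∫ t in P.I, η t * G t c) + inner ℝ y (η t₀ • incl P.Ω c) = 0) (c : H10 P.Ω) :
    (∀ᵐ t ∂(volume.restrict P.I), G t c = 0) ∧ inner ℝ y (incl P.Ω c) = 0 := by
  have hae : ∀ᵐ t ∂(volume.restrict P.I), G t c = 0 := by
    suffices h : ∀ᵐ t, t ∈ Ioo 0 P.T → G t c = 0 by
      refine (ae_restrict_iff' measurableSet_Ioc).2 ?_
      filter_upwards [h, (Ioo_ae_eq_Ioc (μ := volume) (a := 0) (b := P.T)).mem_iff] with t h1 h2 h3
      exact h1 (h2.2 h3)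
    refine isOpen_Ioo.ae_eq_zero_of_integral_contDiff_smul_eq_zero ?_ fun ξ h1 _ h3 => ?_
    · exact ((integrable_apply G c).mono_set Ioo_subset_Ioc_self).locallyIntegrableOn
    -- A test function supported in (0,T) vanishes at t₀, so the boundary term drops out.
    · have h0 : ξ t₀ = 0 := by
        by_contra h0
        exact ht₀ (h3 (subset_tsupport ξ h0))
      have hξ := h ξ h1 c
      rw [h0, zero_smul, inner_zero_right, add_zero] at hξ
      have hsupp : Function.support (fun t => ξ t • G t c) ⊆ Ioo 0 P.T := fun x hx =>
        h3 (subset_tsupport ξ fun h => hx (by simp [h]))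
      rw [← setIntegral_Ioc_eq_of_support hsupp]
      exact hξ
  refine ⟨hae, ?_⟩
  -- With the integral known to vanish, the constant η = 1 isolates the boundary term.
  have h1 := h (fun _ => 1) contDiff_const c
  have e : ∫ t in P.I, 1 * G t c = 0 := by
    refine integral_eq_zero_of_ae ?_
    filter_upwards [hae] with t ht
    simp [ht]
  rwa [e, zero_add, one_smul] at h1

/-- The exceptional null set may depend on c, but on each slab only finitely many c occur. -/
theorem pairing_eq_zero {G : Lp (Hneg P.Ω) 2 (volume.restrict P.I)}
    (hG : ∀ c, ∀ᵐ t ∂(volume.restrict P.I), G t c = 0) {w : Broken D} (hw : SlabSmooth w) :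
    pairing P G w.1 = 0 := by
  rw [← sum_slab_pairing D]
  refine Finset.sum_eq_zero fun n _ => integral_eq_zero_of_ae ?_
  obtain ⟨m, η, c, -, h2, -⟩ := hw n
  filter_upwards [h2, ae_slab (ae_all_iff.2 fun k => hG (c k)) n] with t k2 k3
  have k2' : w.1 t = ∑ k, η k t • c k := k2
  rw [k2']
  simp [k3]

/-- The end values are combinations of elements of H^1_0, so orthogonality to H^1_0 suffices and its
density in L² is not needed. -/
theorem SlabSmooth.inner_leftVal {w : Broken D} (hw : SlabSmooth w) {y : L2 P.Ω}
    (hy : ∀ c, inner ℝ y (incl P.Ω c) = (0 : ℝ)) (n : Fin (D.M + 1)) :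
    inner ℝ y (w.leftVal n) = (0 : ℝ) := by
  obtain ⟨m, η, c, -, -, -, h4, -⟩ := hw n
  rw [h4, inner_sum]
  simp [real_inner_smul_right, hy]

theorem SlabSmooth.inner_rightVal {w : Broken D} (hw : SlabSmooth w) {y : L2 P.Ω}
    (hy : ∀ c, inner ℝ y (incl P.Ω c) = (0 : ℝ)) (n : Fin (D.M + 1)) :
    inner ℝ y (w.rightVal n) = (0 : ℝ) := by
  obtain ⟨m, η, c, -, -, -, -, h5⟩ := hw n
  rw [h5, inner_sum]
  simp [real_inner_smul_right, hy]

theorem V.jump_eq_zero (v : V D) (m : Fin D.M) : (v : Broken D).jump m = 0 := by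
  obtain ⟨-, g, -, -, hgn⟩ := v.2
  rw [Broken.jump, (hgn _).1, (hgn _).2, Fin.succ_castSucc, sub_self]

theorem V.A_eq (u : V D) (φ : Broken D) :
    A (u : Broken D) φ = pairing P ((u : Broken D).2.1 + formL P (u : Broken D).1) φ.1 := by
  simp [A_eq_pairing, V.jump_eq_zero]

theorem V.ADual_eq (z : V D) (ψ : Broken D) :
    ADual (z : Broken D) ψ
      = pairing P (-(z : Broken D).2.1 + formDualL P (z : Broken D).1) ψ.1 := by
  simp [ADual_eq_pairing, V.jump_eq_zero]

/-! ### First variations of the Lagrangian -/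

variable {J : W D → ℝ} {u z : V D}

/-- The Lagrangian is affine in z, so its variation is the coefficient of s. -/
theorem lagrangian_add_smul_right (u : W D) (z φ : V D) (s : ℝ) :
    lagrangian J u (z + s • φ) = lagrangian J u z + s * (F (φ : Broken D) - A u.toBroken φ
      - inner ℝ (u.toBroken.initial - incl P.Ω P.u₀) (φ : Broken D).initial) := by
  unfold lagrangian
  have ez : ((z + s • φ : V D) : Broken D) = (z : Broken D) + s • (φ : Broken D) := rfl
  have hF : F ((z : Broken D) + s • (φ : Broken D)) = F (z : Broken D) + s * F (φ : Broken D) :=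
    (F_add _ _).trans (congrArg _ (F_smul s (φ : Broken D)))
  have hA : A u.toBroken ((z : Broken D) + s • (φ : Broken D))
      = A u.toBroken z + s * A u.toBroken φ :=
    (A_add_right _ _ _).trans (congrArg _ (A_smul_right s u.toBroken (φ : Broken D)))
  have hi : (inner ℝ (u.toBroken.initial - incl P.Ω P.u₀)
        ((z : Broken D) + s • (φ : Broken D)).initial : ℝ)
      = inner ℝ (u.toBroken.initial - incl P.Ω P.u₀) (z : Broken D).initial
        + s * inner ℝ (u.toBroken.initial - incl P.Ω P.u₀) (φ : Broken D).initial :=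
    (inner_add_right _ _ _).trans (congrArg _ (real_inner_smul_right _ _ s))
  rw [ez, hF, hA, hi]
  ring

/-- Apart from J, the Lagrangian is affine in u; only J has to be differentiated. -/
theorem lagrangian_add_smul_left (u ψ : W D) (z : V D) (s : ℝ) :
    lagrangian J (u + s • ψ) z = J (u + s • ψ) + (lagrangian J u z - J u
      - s * (A ψ.toBroken z + inner ℝ ψ.toBroken.initial (z : Broken D).initial)) := by
  unfold lagrangian
  have eu : (u + s • ψ).toBroken = u.toBroken + s • ψ.toBroken := rfl
  have hA : A (u.toBroken + s • ψ.toBroken) (z : Broken D)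
      = A u.toBroken z + s * A ψ.toBroken z :=
    (A_add_left _ _ _).trans (congrArg _ (A_smul_left s ψ.toBroken (z : Broken D)))
  have hi : (inner ℝ ((u.toBroken + s • ψ.toBroken).initial - incl P.Ω P.u₀)
        (z : Broken D).initial : ℝ)
      = inner ℝ (u.toBroken.initial - incl P.Ω P.u₀) (z : Broken D).initial
        + s * inner ℝ ψ.toBroken.initial (z : Broken D).initial := by
    rw [← real_inner_smul_left, ← inner_add_left, ← add_sub_right_comm]
    rfl
  rw [eu, hA, hi]
  ring

/-- Variation of a stationary point in the second argument. -/
theorem IsStationary.primal (h : IsStationary J u z) (φ : V D) :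
    F (φ : Broken D) = A (u : Broken D) φ
      + inner ℝ ((u : Broken D).initial - incl P.Ω P.u₀) (φ : Broken D).initial := by
  have h0 := h 0 φ
  have e0 : ∀ s : ℝ, V.toW u + s • V.toW (0 : V D) = V.toW u := fun s => by
    rw [map_zero, smul_zero, add_zero]
  simp only [e0, lagrangian_add_smul_right] at h0
  have h1 := h0.unique (((hasDerivAt_id (0 : ℝ)).mul_const _).const_add _)
  rw [one_mul, sub_sub] at h1
  exact sub_eq_zero.1 h1.symm

/-- Variation of a stationary point in the first argument. -/
theorem IsStationary.dual (h : IsStationary J u z) (hJ : Differentiable ℝ J) (ψ : V D) :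
    fderiv ℝ J (V.toW u) (V.toW ψ) = A (ψ : Broken D) z
      + inner ℝ (ψ : Broken D).initial (z : Broken D).initial := by
  have h0 := h ψ 0
  have e0 : ∀ s : ℝ, z + s • (0 : V D) = z := fun s => by rw [smul_zero, add_zero]
  simp only [e0, lagrangian_add_smul_left] at h0
  have hl : HasDerivAt (fun s : ℝ => V.toW u + s • V.toW ψ) (V.toW ψ) 0 := by
    simpa using ((hasDerivAt_id (0 : ℝ)).smul_const (V.toW ψ)).const_add (V.toW u)
  have hJ' : HasFDerivAt J (fderiv ℝ J (V.toW u)) (V.toW u + (0 : ℝ) • V.toW ψ) := by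
    rw [zero_smul, add_zero]
    exact (hJ _).hasFDerivAt
  have h1 := h0.unique ((hJ'.comp_hasDerivAt (0 : ℝ) hl).add
    (((hasDerivAt_id (0 : ℝ)).mul_const _).const_sub _))
  rw [one_mul, ← sub_eq_add_neg] at h1
  exact sub_eq_zero.1 h1.symm

/-! ### Extension of the stationarity equations to slabwise smooth test functions -/

theorem pairing_sub_left (G G' : Lp (Hneg P.Ω) 2 (volume.restrict P.I))
    (φ : Lp (H10 P.Ω) 2 (volume.restrict P.I)) :
    pairing P (G - G') φ = pairing P G φ - pairing P G' φ := by
  rw [map_sub, sub_apply]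

/-- An equation which holds for all `η(t) c` holds for all slabwise smooth functions. -/
theorem pairing_eq_of_tensor {G G' : Lp (Hneg P.Ω) 2 (volume.restrict P.I)} {y : L2 P.Ω}
    {t₀ : ℝ} (ht₀ : t₀ ∉ Ioo 0 P.T)
    (h : ∀ (η : ℝ → ℝ) (hη : ContDiff ℝ ∞ η) (c : H10 P.Ω),
      pairing P G (tensor D hη c).1
        = pairing P G' (tensor D hη c).1 + inner ℝ y (η t₀ • incl P.Ω c))
    {w : Broken D} (hw : SlabSmooth w) :
    pairing P G w.1 = pairing P G' w.1 ∧ ∀ c, inner ℝ y (incl P.Ω c) = (0 : ℝ) := by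
  have key := eq_zero_of_tensor (t₀ := t₀) (y := -y) (G := G - G') ht₀ fun η hη c => by
    rw [← pairing_tensor (D := D) _ hη, pairing_sub_left, h η hη c, inner_neg_left]
    ring
  refine ⟨?_, fun c => ?_⟩
  · have h1 := pairing_eq_zero (fun c => (key c).1) hw
    rw [pairing_sub_left] at h1
    exact sub_eq_zero.1 h1
  · have h2 := (key c).2
    rw [inner_neg_left] at h2
    exact neg_eq_zero.1 h2

set_option maxHeartbeats 1000000 in
/-- The primal equation of a stationary point also holds for discrete test functions. -/
theorem IsStationary.primal_slabSmooth (h : IsStationary J u z) {φ : Broken D}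
    (hφ : SlabSmooth φ) :
    F φ = A (u : Broken D) φ
      + inner ℝ ((u : Broken D).initial - incl P.Ω P.u₀) φ.initial := by
  have key := pairing_eq_of_tensor (t₀ := 0) (y := (u : Broken D).initial - incl P.Ω P.u₀)
    (G := l2DualL P P.f) (G' := (u : Broken D).2.1 + formL P (u : Broken D).1)
    (fun h => lt_irrefl _ h.1) (fun η hη c => ?_) hφ
  -- The initial condition holds by itself, and A(u) has no jump terms, so jumps of φ do no harm.
  · have h0 : (inner ℝ ((u : Broken D).initial - incl P.Ω P.u₀) φ.initial : ℝ) = 0 :=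
      hφ.inner_leftVal key.2 0
    rw [F_eq_pairing φ, V.A_eq u φ, h0, add_zero]
    exact key.1
  · obtain ⟨τ, hτ⟩ : ∃ τ : V D, (τ : Broken D) = tensor D hη c := ⟨tensorV D hη c, rfl⟩
    have h0 := h.primal τ
    rw [F_eq_pairing (τ : Broken D), V.A_eq u τ] at h0
    rw [← tensor_initial D hη c, ← hτ]
    exact h0

set_option maxHeartbeats 1000000 in
/-- The dual equation of a stationary point also holds for discrete test functions. -/
theorem IsStationary.dual_slabSmooth (h : IsStationary J u z) (hJ : Differentiable ℝ J)
    {g : Lp (L2 P.Ω) 2 (volume.restrict P.I)}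
    (hg : ∀ ψ : W D, fderiv ℝ J (V.toW u) ψ
      = ∫ t in P.I, inner ℝ (g t) (incl P.Ω (ψ.toBroken.val t)))
    {ψ : W D} (hψ : SlabSmooth ψ.toBroken) :
    fderiv ℝ J (V.toW u) ψ = A ψ.toBroken z
      + inner ℝ ψ.toBroken.initial (z : Broken D).initial := by
  -- The density turns J'(u) into a pairing in time, which can be localized.
  have hg' : ∀ ψ : W D, fderiv ℝ J (V.toW u) ψ = pairing P (l2DualL P g) ψ.toBroken.1 :=
    fun ψ => (hg ψ).trans (pairing_l2DualL g _).symm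
  have key := pairing_eq_of_tensor (t₀ := P.T) (y := (z : Broken D).final)
    (G := l2DualL P g) (G' := -(z : Broken D).2.1 + formDualL P (z : Broken D).1)
    (fun h => lt_irrefl _ h.2) (fun η hη c => ?_) hψ
  · have h0 : (inner ℝ (z : Broken D).final ψ.toBroken.final : ℝ) = 0 :=
      hψ.inner_rightVal key.2 (Fin.last D.M)
    -- Passing to A*(z) moves the time derivative and the jumps from ψ to z, which has no jumps; the
    -- final value of z is orthogonal to that of ψ.
    rw [A_eq_ADual ((V.slabRegular z).timeParts hψ).symm, hg' ψ,
      V.ADual_eq z ψ.toBroken, h0, add_zero]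
    exact key.1
  · obtain ⟨τ, hτ⟩ : ∃ τ : V D, (τ : Broken D) = tensor D hη c := ⟨tensorV D hη c, rfl⟩
    have h0 := (hg' (V.toW τ)).symm.trans (h.dual hJ τ)
    have hτs : SlabSmooth (τ : Broken D) := hτ ▸ tensor_slabSmooth D hη c
    rw [A_eq_ADual ((V.slabRegular z).timeParts hτs).symm, V.ADual_eq z τ] at h0
    rw [← tensor_final D hη c, ← hτ]
    exact h0

end Stationary

/-! ### The discrete residuals -/

section Residuals

variable {d : ℕ} {P : Problem d} {D : Discretization P}

theorem rho_add (u : DG D) (φ χ : W D) : rho u (φ + χ) = rho u φ + rho u χ := by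
  have e : (φ + χ).toBroken = φ.toBroken + χ.toBroken := rfl
  rw [rho, rho, rho, e, F_add, A_add_right, Broken.initial_add, inner_add_right]
  ring

theorem rhoDual_add (J : W D → ℝ) (u z : DG D) (φ χ : W D) :
    rhoDual J u z (φ + χ) = rhoDual J u z φ + rhoDual J u z χ := by
  have e : (φ + χ).toBroken = φ.toBroken + χ.toBroken := rfl
  rw [rhoDual, rhoDual, rhoDual, e, map_add, ADual_add_right, Broken.final_add, inner_add_right]
  ring

theorem DG.toBroken_toW (v : DG D) : v.toW.toBroken = DG.toBroken v := rfl

/-- The perturbed Galerkin orthogonality of the stabilized scheme. -/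
theorem SolvesPrimal.rho_eq {u : DG D} (h : SolvesPrimal u) (φ : DG D) :
    rho u φ.toW = S u φ := by
  rw [rho, φ.toBroken_toW, inner_sub_left]
  linarith [h φ]

theorem SolvesDual.rhoDual_eq {J : W D → ℝ} {j : W D → Lp (L2 P.Ω) 2 (volume.restrict P.I)}
    {u z : DG D} (h : SolvesDual J j u z) (ψ : DG D) :
    rhoDual J u z ψ.toW = SDual (j u.toW) z ψ := by
  rw [rhoDual, ψ.toBroken_toW]
  linarith [h ψ]

/-- The fundamental theorem of calculus for s ↦ J'(x + se)(e); continuity of J'' makes the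
derivative integrable. -/
theorem integral_fderiv_fderiv {E : Type*} [NormedAddCommGroup E] [NormedSpace ℝ E] {J : E → ℝ}
    (hJ' : Differentiable ℝ (fderiv ℝ J)) (hJ'' : Continuous (fderiv ℝ (fderiv ℝ J))) (x e : E) :
    ∫ s in (0 : ℝ)..1, fderiv ℝ (fderiv ℝ J) (x + s • e) e e
      = fderiv ℝ J (x + e) e - fderiv ℝ J x e := by
  have hl : ∀ s : ℝ, HasDerivAt (fun s : ℝ => x + s • e) e s := fun s => by
    simpa using ((hasDerivAt_id s).smul_const e).const_add x
  have hd : ∀ s : ℝ, HasDerivAt (fun s : ℝ => fderiv ℝ J (x + s • e) e)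
      (fderiv ℝ (fderiv ℝ J) (x + s • e) e e) s := fun s => by
    have h1 := (hJ' (x + s • e)).hasFDerivAt.comp_hasDerivAt s (hl s)
    simpa using h1.clm_apply (hasDerivAt_const s e)
  rw [intervalIntegral.integral_eq_sub_of_hasDerivAt (fun s _ => hd s)]
  · simp
  · exact Continuous.intervalIntegrable (by fun_prop) _ _

end Residuals

end DWR

end

/-! ### The error identity -/

set_option maxHeartbeats 2000000 in
theorem mainTheorem3 {d : ℕ} (hd : d = 2 ∨ d = 3) (P : Problem d) (D : Discretization P)
    -- the goal functional, three times Fréchet differentiable on `V + V_{τh}`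
    (J : W D → ℝ) (hJ : Differentiable ℝ J) (hJ' : Differentiable ℝ (fderiv ℝ J))
    (hJ'' : Differentiable ℝ (fderiv ℝ (fderiv ℝ J)))
    -- `J'(v)(ψ) = ∫_I (j(v),ψ) dt`
    (j : W D → Lp (L2 P.Ω) 2 (volume.restrict P.I))
    (hj : ∀ v ψ : W D, fderiv ℝ J v ψ
      = ∫ t in P.I, inner ℝ (j v t) (incl P.Ω (ψ.toBroken.val t)))
    (u z : V D) (huz : IsStationary J u z)
    (uh zh : DG D) (huh : SolvesPrimal uh) (hzh : SolvesDual J j uh zh)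
    (φh ψh : DG D) :
    rhoDual J uh zh (V.toW u - ψh.toW)
      = rho uh (V.toW z - φh.toW) + S uh (φh - zh) + SDual (j uh.toW) zh (uh - ψh)
        + (-∫ s in (0 : ℝ)..1, fderiv ℝ (fderiv ℝ J) (uh.toW + s • (V.toW u - uh.toW))
            (V.toW u - uh.toW) (V.toW u - uh.toW)) := by
  set e := V.toW u - uh.toW with he
  set q := V.toW z - zh.toW with hq
  have hue : (u : Broken D) = DG.toBroken uh + e.toBroken := by
    have h : V.toW u = uh.toW + e := by rw [he]; abel
    exact congrArg W.toBroken h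
  have hzq : (z : Broken D) = DG.toBroken zh + q.toBroken := by
    have h : V.toW z = zh.toW + q := by rw [hq]; abel
    exact congrArg W.toBroken h
  -- the duality of `A` and `A*` for the error
  have hparts : A e.toBroken (DG.toBroken zh) + inner ℝ e.toBroken.initial (DG.toBroken zh).initial
      = ADual (DG.toBroken zh) e.toBroken
        + inner ℝ (DG.toBroken zh).final e.toBroken.final := by
    have h : TimeParts e.toBroken (DG.toBroken zh) := by
      -- The error is split into its part in V and its discrete part; each may be integrated by
      -- parts against z_τh.
      have h' : e.toBroken = (u : Broken D) + DG.toBroken (-uh) := by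
        rw [hue, map_neg]; abel
      rw [h']
      exact ((V.slabRegular u).timeParts zh.slabSmooth).add_left
        ((-uh).slabSmooth.regular.timeParts zh.slabSmooth)
    exact A_eq_ADual h
  -- The primal equation for the non-admissible direction q: tested with z ∈ V minus tested with
  -- z_τh.
  have hqF : F q.toBroken = A (u : Broken D) q.toBroken
      + inner ℝ ((u : Broken D).initial - incl P.Ω P.u₀) q.toBroken.initial := by
    have h1 := huz.primal z
    have h2 := huz.primal_slabSmooth zh.slabSmooth
    rw [hzq, F_add, A_add_right, Broken.initial_add, inner_add_right] at h1
    linarith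
  have heJ : fderiv ℝ J (V.toW u) e = A e.toBroken z
      + inner ℝ e.toBroken.initial (z : Broken D).initial := by
    have h1 := huz.dual hJ u
    have h2 := huz.dual_slabSmooth hJ (hj (V.toW u)) (ψ := uh.toW) uh.slabSmooth
    rw [uh.toBroken_toW] at h2
    rw [he, map_sub, h1, h2, ← he, hue, A_add_left, Broken.initial_add, inner_add_left]
    ring
  have hrho : rho uh q = A e.toBroken q.toBroken
      + inner ℝ e.toBroken.initial q.toBroken.initial := by
    rw [rho, hqF, hue, A_add_left, Broken.initial_add, inner_sub_left, inner_sub_left,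
      inner_add_left]
    ring
  have hrhoDual : rhoDual J uh zh e = fderiv ℝ J uh.toW e - A e.toBroken (DG.toBroken zh)
      - inner ℝ e.toBroken.initial (DG.toBroken zh).initial := by
    rw [rhoDual]
    linarith
  rw [hzq, A_add_right, Broken.initial_add, inner_add_right] at heJ
  have hΔ := integral_fderiv_fderiv hJ' hJ''.continuous uh.toW e
  have hsum : uh.toW + e = V.toW u := by rw [he]; abel
  rw [hsum] at hΔ
  -- S(u_τh)(φ_τh - z_τh) is the residual of φ_τh - z_τh, so φ_τh cancels.
  have hφ : rho uh (V.toW z - φh.toW) + S uh (φh - zh) = rho uh q := by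
    rw [← huh.rho_eq, ← rho_add, map_sub, hq]
    congr 1
    abel
  have hψ : rhoDual J uh zh (V.toW u - ψh.toW)
      = rhoDual J uh zh e + SDual (j uh.toW) zh (uh - ψh) := by
    rw [← hzh.rhoDual_eq, ← rhoDual_add, map_sub, he]
    congr 1
    abel
  -- The terms pairing e with z_τh and with q add up to J'(u)(e).
  rw [hψ, hφ, hΔ, hrhoDual, hrho]
  linarith
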